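/- Let $k>\tfrac32$ be an integer and let $\Omega\subseteq\mathbb R^3$ be a bounded $H^{k+1}$-domain, i.e. a bounded open connected set for which there are a bounded $\mathscr C^\infty$-domain $O$ and a continuous $\psi:\overline O\to\overline\Omega$ that restricts to bijections $O\to\Omega$ and $\partial O\to\partial\Omega$ with differentiable inverses, with $\psi\in H^{k+1}(O)$ and $\psi^{-1}\in H^{k+1}(\Omega)$. Let $\mathbf N$ be the outward-pointing unit normal on $\partial\Omega$, and let $w:\overline\Omega\to\mathbb R^3$ be a vector field that is differentiable up to the boundary. A local chart $(\mathcal U,\vartheta)$ is a $\mathscr C^1$-diffeomorphism $\vartheta$ of a ball $B(0,r)\subseteq\mathbb R^3$ onto an open set $\mathcal U\subseteq\mathbb R^3$ that maps $B(0,r)\cap\{y_3=0\}$ onto $\mathcal U\cap\partial\Omega$ and $B(0,r)\cap\{y_3>0\}$ onto $\mathcal U\cap\Omega$. On $\{y_3=0\}$ write $\vartheta=\vartheta(y_1,y_2)$, let Greek indices run over $1,2$ with summation over repeated indices, and put $g_{\alpha\beta}=\partial_\alpha\vartheta\cdot\partial_\beta\vartheta$, $[g^{\alpha\beta}]=[g_{\alpha\beta}]^{-1}$,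 $\mathrm g=\det[g_{\alpha\beta}]$, $b_{\alpha\beta}=-\partial_\alpha\partial_\beta\vartheta\cdot(\mathbf N\circ\vartheta)$. The mean curvature is $H\circ\vartheta=\tfrac12 g^{\alpha\beta}b_{\alpha\beta}$; the tangential gradient of a scalar function is $(\nabla^{\partial\Omega}\varphi)\circ\vartheta=g^{\alpha\beta}\,\partial_\alpha(\varphi\circ\vartheta)\,\partial_\beta\vartheta$, and $\nabla^{\partial\Omega}w\cdot\mathbf N=\sum_i \mathbf N^i\,\nabla^{\partial\Omega}w^i$; the surface divergence of a tangent field is $(\operatorname{div}^{\partial\Omega}u)\circ\vartheta=\mathrm g^{-1/2}\,\partial_\alpha\big[\mathrm g^{1/2}g^{\alpha\beta}\,(u\circ\vartheta)\cdot\partial_\beta\vartheta\big]$; and $\mathrm P_{\mathbf N^\perp}v=v-(v\cdot\mathbf N)\mathbf N$. Then in every local chart: 1. at every point of $\mathcal U\cap\partial\Omega$, $$\mathrm P_{\mathbf N^\perp}\Big(\frac{\partial w}{\partial\mathbf N}\Big)=\operatorname{curl}w\times\mathbf N+\nabla^{\partial\Omega}w\cdot\mathbf N;$$ 2. at every point $\vartheta(y_1,y_2)$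 of $\mathcal U\cap\partial\Omega$ at which $(y_1,y_2)\mapsto\vartheta(y_1,y_2,0)$ is twice differentiable, $$\operatorname{div}w=\frac{\partial w}{\partial\mathbf N}\cdot\mathbf N+2H\,(w\cdot\mathbf N)+\operatorname{div}^{\partial\Omega}(\mathrm P_{\mathbf N^\perp}w),\qquad \operatorname{curl}w\cdot\mathbf N=\operatorname{div}^{\partial\Omega}(w\times\mathbf N).$$ Moreover, if the chart is of class $H^{k+1}$ (that is, $\vartheta\in H^{k+1}(B(0,r))$), then $(y_1,y_2)\mapsto\vartheta(y_1,y_2,0)$ is twice differentiable at almost every $(y_1,y_2)$ with $y_1^2+y_2^2<r^2$, so that all three identities hold almost everywhere on $\mathcal U\cap\partial\Omega$. -/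

import Mathlib

open MeasureTheory Set Topology
open scoped ContDiff

noncomputable section

namespace SobolevDomain

/-- Euclidean space `ℝ³`. -/
abbrev E3 := EuclideanSpace ℝ (Fin 3)

/-- Euclidean space `ℝ²`, in which the boundary charts take their parameters. -/
abbrev E2 := EuclideanSpace ℝ (Fin 2)

/-! ### Sobolev spaces -/

/-- `g` is the weak partial derivative `∂f/∂x_i` on the open set `Ω`. -/
def HasWeakPartial (Ω : Set E3) (i : Fin 3) (f g : E3 → ℝ) : Prop :=
  ∀ φ : E3 → ℝ, ContDiff ℝ ∞ φ → HasCompactSupport φ → tsupport φ ⊆ Ω →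
    ∫ x in Ω, f x * fderiv ℝ φ x (EuclideanSpace.single i 1) = -∫ x in Ω, g x * φ x

/-- `f ∈ H^m(Ω)`: all weak partial derivatives of `f` of order at most `m` exist
and are square integrable on `Ω`. -/
def MemH : ℕ → Set E3 → (E3 → ℝ) → Prop
  | 0, Ω, f => MemLp f 2 (volume.restrict Ω)
  | m + 1, Ω, f => MemLp f 2 (volume.restrict Ω) ∧
      ∀ i : Fin 3, ∃ g : E3 → ℝ, HasWeakPartial Ω i f g ∧ MemH m Ω g

/-- `ψ ∈ H^m(Ω; ℝ³)`, componentwise. -/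
def MemHVec (m : ℕ) (Ω : Set E3) (ψ : E3 → E3) : Prop :=
  ∀ i : Fin 3, MemH m Ω (fun x => ψ x i)

/-! ### Charts, smooth domains and `H^m`-domains -/

/-- A local chart `(U, ϑ)` of class `C^n` for `Ω` at its boundary: `ϑ` is a `C^n`-diffeomorphism
of a ball `B(0, r)` onto an open set `U`, which carries `B(0, r) ∩ {y₃ = 0}` onto `U ∩ ∂Ω` and
`B(0, r) ∩ {y₃ > 0}` onto `U ∩ Ω`. -/
structure BoundaryChart (n : WithTop ℕ∞) (Ω : Set E3) where
  /-- the radius `r` of the ball of parameters -/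
  radius : ℝ
  /-- the open set `U` -/
  target : Set E3
  /-- the map `ϑ` (only its values on the ball matter) -/
  toFun : E3 → E3
  /-- the inverse of `ϑ` (only its values on `U` matter) -/
  invFun : E3 → E3
  radius_pos : 0 < radius
  isOpen_target : IsOpen target
  bijOn : BijOn toFun (Metric.ball 0 radius) target
  leftInvOn : LeftInvOn invFun toFun (Metric.ball 0 radius)
  contDiffOn_toFun : ContDiffOn ℝ n toFun (Metric.ball 0 radius)
  contDiffOn_invFun : ContDiffOn ℝ n invFun target
  image_flat : toFun '' (Metric.ball 0 radius ∩ {y | y 2 = 0}) = target ∩ frontier Ω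
  image_upper : toFun '' (Metric.ball 0 radius ∩ {y | 0 < y 2}) = target ∩ Ω

/-- A bounded domain: a bounded, open and connected (hence nonempty) subset of `ℝ³`. -/
def IsBoundedDomain (Ω : Set E3) : Prop :=
  IsOpen Ω ∧ IsConnected Ω ∧ Bornology.IsBounded Ω

/-- A bounded `C^∞`-domain. -/
def IsBoundedSmoothDomain (Ω : Set E3) : Prop :=
  IsBoundedDomain Ω ∧ ∀ x ∈ frontier Ω, ∃ c : BoundaryChart ∞ Ω, x ∈ c.target

/-- `ψ`, with inverse `χ`, is an `H^m`-diffeomorphism of the closure of `O` onto that of `Ω`. -/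
structure IsHDiffeo (m : ℕ) (O Ω : Set E3) (ψ χ : E3 → E3) : Prop where
  continuousOn : ContinuousOn ψ (closure O)
  bijOn : BijOn ψ O Ω
  bijOn_frontier : BijOn ψ (frontier O) (frontier Ω)
  leftInvOn : LeftInvOn χ ψ (closure O)
  differentiableOn_inv : DifferentiableOn ℝ χ Ω
  differentiableOn_inv_frontier : DifferentiableOn ℝ χ (frontier Ω)
  memH : MemHVec m O ψ
  memH_inv : MemHVec m Ω χ

/-- `Ω` is a bounded `H^m`-domain (the notion is used for `m > 5/2`): a bounded domain that is
the `H^m`-diffeomorphic image of a bounded `C^∞`-domain. -/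
def IsBoundedHDomain (m : ℕ) (Ω : Set E3) : Prop :=
  IsBoundedDomain Ω ∧
    ∃ (O : Set E3) (ψ χ : E3 → E3), IsBoundedSmoothDomain O ∧ IsHDiffeo m O Ω ψ χ

/-- `ν` is the outward-pointing unit normal to `∂Ω` at `x`. -/
def IsOutwardUnitNormal (Ω : Set E3) (x ν : E3) : Prop :=
  ‖ν‖ = 1 ∧ (∀ v ∈ tangentConeAt ℝ (frontier Ω) x, inner ℝ v ν = 0) ∧
    ∀ᶠ t : ℝ in 𝓝[>] 0, x - t • ν ∈ Ω ∧ x + t • ν ∉ closure Ω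

/-! ### Vector calculus, up to the boundary -/

/-- The vector product in `ℝ³`. -/
def cross (u v : E3) : E3 :=
  WithLp.toLp 2 (crossProduct (WithLp.ofLp u) (WithLp.ofLp v))

/-- The derivative, up to the boundary, of a vector field on the closure of `Ω`. -/
def grad (Ω : Set E3) (w : E3 → E3) (x : E3) : E3 →L[ℝ] E3 :=
  fderivWithin ℝ w (closure Ω) x

/-- The partial derivative `∂w^j/∂x_i`. -/
def dpart (Ω : Set E3) (w : E3 → E3) (i j : Fin 3) (x : E3) : ℝ :=
  grad Ω w x (EuclideanSpace.single i 1) j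

/-- `div w`. -/
def divergence (Ω : Set E3) (w : E3 → E3) (x : E3) : ℝ :=
  ∑ i, dpart Ω w i i x

/-- `curl w`. -/
def curl (Ω : Set E3) (w : E3 → E3) (x : E3) : E3 :=
  !₂[dpart Ω w 1 2 x - dpart Ω w 2 1 x,
     dpart Ω w 2 0 x - dpart Ω w 0 2 x,
     dpart Ω w 0 1 x - dpart Ω w 1 0 x]

/-- The directional derivative `∂w/∂ν`. -/
def normalDeriv (Ω : Set E3) (w : E3 → E3) (ν : E3) (x : E3) : E3 :=
  grad Ω w x ν

/-- The projection `v - (v · ν) ν` onto the plane orthogonal to the unit vector `ν`. -/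
def tanProj (ν v : E3) : E3 := v - (inner ℝ v ν) • ν

/-! ### Differential operators on the boundary, in a local chart

Below `ϑ : ℝ² → ℝ³` is the parametrization `(y₁, y₂) ↦ ϑ(y₁, y₂, 0)` of a piece of the boundary;
each operator is given by its value at the point `ϑ(y)`. -/

/-- The parametrization of `U ∩ ∂Ω` given by a chart. -/
def BoundaryChart.surf {n : WithTop ℕ∞} {Ω : Set E3} (c : BoundaryChart n Ω) (y : E2) : E3 :=
  c.toFun !₂[y 0, y 1, 0]

/-- The partial derivative `∂f/∂y_α`. -/
def pd {F : Type*} [NormedAddCommGroup F] [NormedSpace ℝ F] (α : Fin 2) (f : E2 → F) (y : E2) : F :=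
  lineDeriv ℝ f y (EuclideanSpace.single α 1)

/-- The induced metric `g_{αβ}`. -/
def metric (ϑ : E2 → E3) (y : E2) : Matrix (Fin 2) (Fin 2) ℝ :=
  Matrix.of fun α β => inner ℝ (pd α ϑ y) (pd β ϑ y)

/-- The second fundamental form `b_{αβ} = -(∂²ϑ/∂y_α∂y_β) · N`. -/
def secondForm (N : E3 → E3) (ϑ : E2 → E3) (y : E2) : Matrix (Fin 2) (Fin 2) ℝ :=
  Matrix.of fun α β => -inner ℝ (pd α (fun z => pd β ϑ z) y) (N (ϑ y))

/-- The mean curvature `H = (1/2) g^{αβ} b_{αβ}`. -/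
def meanCurvature (N : E3 → E3) (ϑ : E2 → E3) (y : E2) : ℝ :=
  (1 / 2) * ∑ α, ∑ β, (metric ϑ y)⁻¹ α β * secondForm N ϑ y α β

/-- The tangential gradient of a scalar function on the boundary. -/
def tanGrad (φ : E3 → ℝ) (ϑ : E2 → E3) (y : E2) : E3 :=
  ∑ α, ∑ β, ((metric ϑ y)⁻¹ α β * pd α (fun z => φ (ϑ z)) y) • pd β ϑ y

/-- `∇^{∂Ω} u · v = ∑ᵢ vⁱ ∇^{∂Ω} uⁱ` for vector fields `u`, `v` on the boundary. -/
def tanGradDot (u v : E3 → E3) (ϑ : E2 → E3) (y : E2) : E3 :=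
  ∑ i : Fin 3, (v (ϑ y) i) • tanGrad (fun x => u x i) ϑ y

/-- The surface divergence of a tangent vector field on the boundary. -/
def surfDiv (u : E3 → E3) (ϑ : E2 → E3) (y : E2) : ℝ :=
  (1 / √(metric ϑ y).det) *
    ∑ α, pd α (fun z => √(metric ϑ z).det *
      ∑ β, (metric ϑ z)⁻¹ α β * inner ℝ (u (ϑ z)) (pd β ϑ z)) y

end SobolevDomain

end

open SobolevDomain

open SobolevDomain

noncomputable section

namespace SobolevDomain

/-! ### Linear algebra in `ℝ³` -/

/-! The identities. Write `A` for the derivative of `w` at a boundary point, `n = ∂₁ϑ × ∂₂ϑ / |∂₁ϑ ×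
∂₂ϑ|`, and `N = s n` with `s = ±1`. Since `curl w × N = A N - Aᵀ N` and `∇^{∂Ω} w · N` is the
tangential part of `Aᵀ N`, identity 1 is the splitting of `Aᵀ N` into normal and tangential parts
(`normal_add_tangential`). For the other two, the vectors `√g g^{αβ} ∂_βϑ` are the cross products
`∂₂ϑ × n` and `n × ∂₁ϑ` (`inv_metric_mul_sum`), so the surface divergence loses its inverse matrix
and its square roots (`surfDiv_eq`). The product rule then splits `div^{∂Ω}(P w)` into the
tangential trace of `A` and `w · ∑ ∂_α (√g g^{αβ} ∂_βϑ)`; by symmetry of second derivatives and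
Weingarten this sum is a multiple of `H n` (`sum_pd_conormal`, `two_mul_meanCurvature`). For `w × N`
the pairings reduce to `w · ∂_αϑ`, and second derivatives cancel, leaving the antisymmetric part of
`A` on the tangent plane, which is `curl w · N`. The sign `s` must be locally constant
(`exists_normal_eq_smul`): it is opposite to that of the Jacobian determinant of the chart, because
`∂₃ϑ` points into `Ω`.

Almost everywhere twice differentiable. Since `k + 1 ≥ 3`, each first derivative `u` of the chart is
continuous with a weak Laplacian `L ∈ L²`. Locally `u` is a smooth term plus a truncated Newtonian
potential of `L` (`newton_representation`). Differentiating the potential at `x` requires control of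
`∫ |L(z)| |z - x|⁻² dz`, which `L ∈ L²` alone does not give; a finite energy `∫ L² |z - x|^{-3/2}
dz` does (`differentiableAt_potential`). As `3/2 < 2`, integrating `|z - x|^{-3/2}` over `x` in a
bounded piece of the plane is bounded uniformly in `z`, so Tonelli makes this energy finite for
almost every `x` in the plane (`ae_integrableOn_sq_mul_rootWeight`). At such points `u` is
differentiable in all of `ℝ³`, hence along the plane. -/

theorem cross_apply_zero (u v : E3) : cross u v 0 = u 1 * v 2 - u 2 * v 1 := by
  simp [cross, cross_apply]

theorem cross_apply_one (u v : E3) : cross u v 1 = u 2 * v 0 - u 0 * v 2 := by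
  simp [cross, cross_apply]

theorem cross_apply_two (u v : E3) : cross u v 2 = u 0 * v 1 - u 1 * v 0 := by
  simp [cross, cross_apply]

theorem inner_eq_sum_three (u v : E3) : inner ℝ u v = u 0 * v 0 + u 1 * v 1 + u 2 * v 2 := by
  simp [PiLp.inner_apply, Fin.sum_univ_three, mul_comm]

theorem E3.ext_three {u v : E3} (h0 : u 0 = v 0) (h1 : u 1 = v 1) (h2 : u 2 = v 2) : u = v := by
  ext i; fin_cases i <;> assumption

/-- The vector product as a continuous bilinear map. -/
def crossL : E3 →L[ℝ] E3 →L[ℝ] E3 :=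
  LinearMap.toContinuousBilinearMap (LinearMap.mk₂ ℝ cross
    (fun u u' v => by
      apply E3.ext_three <;> simp [cross_apply_zero, cross_apply_one, cross_apply_two] <;> ring)
    (fun c u v => by
      apply E3.ext_three <;> simp [cross_apply_zero, cross_apply_one, cross_apply_two] <;> ring)
    (fun u v v' => by
      apply E3.ext_three <;> simp [cross_apply_zero, cross_apply_one, cross_apply_two] <;> ring)
    (fun c u v => by
      apply E3.ext_three <;> simp [cross_apply_zero, cross_apply_one, cross_apply_two] <;> ring))

theorem crossL_apply (u v : E3) : crossL u v = cross u v := rfl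

/-- With `m = a × b`, the basis dual to `a, b, m` is `b × m, m × a, m`, each divided by `|m|²`.
Clearing this denominator leaves a polynomial identity that needs no linear independence. -/
theorem gram_decomposition (a b v : E3) :
    (inner ℝ (cross a b) (cross a b)) • v =
      (inner ℝ v (cross a b)) • cross a b + (inner ℝ v a) • cross b (cross a b)
        + (inner ℝ v b) • cross (cross a b) a := by
  apply E3.ext_three <;>
  simp only [PiLp.add_apply, PiLp.smul_apply, smul_eq_mul, inner_eq_sum_three, cross_apply_zero,
    cross_apply_one, cross_apply_two] <;> ring

theorem cross_cross_left (a b : E3) :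
    cross b (cross a b) = (inner ℝ b b) • a - (inner ℝ a b) • b := by
  apply E3.ext_three <;>
  simp only [PiLp.sub_apply, PiLp.smul_apply, smul_eq_mul, inner_eq_sum_three, cross_apply_zero,
    cross_apply_one, cross_apply_two] <;> ring

theorem cross_cross_right (a b : E3) :
    cross (cross a b) a = (inner ℝ a a) • b - (inner ℝ a b) • a := by
  apply E3.ext_three <;>
  simp only [PiLp.sub_apply, PiLp.smul_apply, smul_eq_mul, inner_eq_sum_three, cross_apply_zero,
    cross_apply_one, cross_apply_two] <;> ring

theorem inner_cross_self (a b : E3) :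
    inner ℝ (cross a b) (cross a b) = inner ℝ a a * inner ℝ b b - inner ℝ a b * inner ℝ a b := by
  simp only [inner_eq_sum_three, cross_apply_zero, cross_apply_one, cross_apply_two]; ring

theorem cross_anticomm' (a b : E3) : cross a b = -cross b a := by
  apply E3.ext_three <;>
  simp [cross_apply_zero, cross_apply_one, cross_apply_two] <;> ring

theorem cross_smul_right (c : ℝ) (a b : E3) : cross a (c • b) = c • cross a b :=
  (crossL a).map_smul c b

theorem cross_smul_left (c : ℝ) (a b : E3) : cross (c • a) b = c • cross a b := by
  rw [← crossL_apply, map_smul]; rfl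

theorem inner_cross_cross (a b c d : E3) :
    inner ℝ (cross a b) (cross c d) = inner ℝ a c * inner ℝ b d - inner ℝ a d * inner ℝ b c := by
  simp only [inner_eq_sum_three, cross_apply_zero, cross_apply_one, cross_apply_two]; ring

/-- The vector product of two vectors orthogonal to a unit vector `n` is a multiple of `n`. -/
theorem cross_eq_smul_of_orthogonal {n a b : E3} (hn : inner ℝ n n = 1) (ha : inner ℝ a n = 0)
    (hb : inner ℝ b n = 0) : cross a b = (inner ℝ (cross a b) n) • n := by
  simp only [inner_eq_sum_three] at *
  apply E3.ext_three <;>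
  simp only [PiLp.smul_apply, smul_eq_mul, cross_apply_zero, cross_apply_one, cross_apply_two]
  · linear_combination (-(a 1 * b 2 - a 2 * b 1)) * hn + (n 1 * b 2 - n 2 * b 1) * ha
      - (n 1 * a 2 - n 2 * a 1) * hb
  · linear_combination (-(a 2 * b 0 - a 0 * b 2)) * hn + (n 2 * b 0 - n 0 * b 2) * ha
      - (n 2 * a 0 - n 0 * a 2) * hb
  · linear_combination (-(a 0 * b 1 - a 1 * b 0)) * hn + (n 0 * b 1 - n 1 * b 0) * ha
      - (n 0 * a 1 - n 1 * a 0) * hb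

theorem E3.eq_sum_single (v : E3) :
    v = v 0 • EuclideanSpace.single 0 1 + v 1 • EuclideanSpace.single 1 1
      + v 2 • EuclideanSpace.single 2 1 := by
  apply E3.ext_three <;> simp

theorem clm_apply_coord (A : E3 →L[ℝ] E3) (v : E3) (j : Fin 3) :
    A v j = v 0 * A (EuclideanSpace.single 0 1) j + v 1 * A (EuclideanSpace.single 1 1) j
      + v 2 * A (EuclideanSpace.single 2 1) j := by
  conv_lhs => rw [E3.eq_sum_single v]
  simp

/-- The trace computed in the basis `a, b, a × b` and its dual basis, with the same denominator
cleared. -/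
theorem trace_decomposition (A : E3 →L[ℝ] E3) (a b : E3) :
    (inner ℝ (cross a b) (cross a b)) * ∑ i, A (EuclideanSpace.single i 1) i =
      inner ℝ (A (cross a b)) (cross a b) + inner ℝ (A a) (cross b (cross a b))
        + inner ℝ (A b) (cross (cross a b) a) := by
  rw [Fin.sum_univ_three]
  simp only [inner_eq_sum_three, clm_apply_coord A (cross a b), clm_apply_coord A a,
    clm_apply_coord A b, cross_apply_zero, cross_apply_one, cross_apply_two]
  ring

/-- The curl represents the antisymmetric part of the derivative as a bilinear form. -/
theorem inner_curl_cross (Ω : Set E3) (w : E3 → E3) (x a b : E3) :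
    inner ℝ (curl Ω w x) (cross a b) =
      inner ℝ (grad Ω w x a) b - inner ℝ (grad Ω w x b) a := by
  simp only [inner_eq_sum_three, clm_apply_coord _ a, clm_apply_coord _ b, cross_apply_zero,
    cross_apply_one, cross_apply_two, curl, dpart]
  simp
  ring

/-- The subtracted sum is the transpose of the derivative applied to `ν`, written in coordinates. -/
theorem cross_curl (Ω : Set E3) (w : E3 → E3) (x ν : E3) :
    cross (curl Ω w x) ν = grad Ω w x ν -
      ∑ i : Fin 3, inner ℝ (grad Ω w x (EuclideanSpace.single i 1)) ν •
        EuclideanSpace.single i (1 : ℝ) := by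
  apply E3.ext_three <;>
  simp [Fin.sum_univ_three, inner_eq_sum_three, clm_apply_coord _ ν, cross_apply_zero,
    cross_apply_one, cross_apply_two, curl, dpart] <;> ring

/-! ### Parametrized surfaces -/

/-- The vector `∂₁ϑ × ∂₂ϑ`. -/
def rawNormal (S : E2 → E3) (z : E2) : E3 := cross (pd 0 S z) (pd 1 S z)

/-- The unit normal `∂₁ϑ × ∂₂ϑ / |∂₁ϑ × ∂₂ϑ|`. -/
def unitNormal (S : E2 → E3) (z : E2) : E3 := ‖rawNormal S z‖⁻¹ • rawNormal S z

/-- The vector `√g g^{αβ} ∂_βϑ`. -/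
def conormal (S : E2 → E3) : Fin 2 → E2 → E3 :=
  ![fun z => cross (pd 1 S z) (unitNormal S z), fun z => cross (unitNormal S z) (pd 0 S z)]

theorem det_metric (S : E2 → E3) (z : E2) :
    (metric S z).det = inner ℝ (rawNormal S z) (rawNormal S z) := by
  rw [Matrix.det_fin_two, rawNormal, inner_cross_self]
  simp [metric, real_inner_comm]

theorem sqrt_det_metric (S : E2 → E3) (z : E2) : √(metric S z).det = ‖rawNormal S z‖ := by
  rw [det_metric, real_inner_self_eq_norm_sq, Real.sqrt_sq (norm_nonneg _)]

theorem inner_unitNormal_self {S : E2 → E3} {z : E2} (h : rawNormal S z ≠ 0) :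
    inner ℝ (unitNormal S z) (unitNormal S z) = 1 := by
  rw [real_inner_self_eq_norm_sq, unitNormal, norm_smul, norm_inv, norm_norm,
    inv_mul_cancel₀ (norm_ne_zero_iff.mpr h), one_pow]

theorem inner_pd_rawNormal (S : E2 → E3) (z : E2) (β : Fin 2) :
    inner ℝ (pd β S z) (rawNormal S z) = 0 := by
  fin_cases β <;>
  simp only [rawNormal, inner_eq_sum_three, cross_apply_zero, cross_apply_one, cross_apply_two,
    Fin.zero_eta, Fin.mk_one] <;> ring

theorem inner_pd_unitNormal (S : E2 → E3) (z : E2) (β : Fin 2) :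
    inner ℝ (pd β S z) (unitNormal S z) = 0 := by
  rw [unitNormal, inner_smul_right, inner_pd_rawNormal, mul_zero]

theorem inner_conormal_unitNormal (S : E2 → E3) (z : E2) (α : Fin 2) :
    inner ℝ (conormal S α z) (unitNormal S z) = 0 := by
  fin_cases α <;>
  simp only [conormal, inner_eq_sum_three, cross_apply_zero, cross_apply_one, cross_apply_two,
    Fin.zero_eta, Fin.mk_one, Matrix.cons_val_zero, Matrix.cons_val_one] <;> ring

/-- The 2×2 adjugate formula matches the expansion of a triple product: `g₂₂ ∂₁ϑ - g₁₂ ∂₂ϑ = ∂₂ϑ ×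
(∂₁ϑ × ∂₂ϑ)`, and similarly for the other index. -/
theorem inv_metric_mul_sum {S : E2 → E3} {z : E2} (h : rawNormal S z ≠ 0) (α : Fin 2) :
    ‖rawNormal S z‖ • ∑ β, (metric S z)⁻¹ α β • pd β S z = conormal S α z := by
  have hn : ‖rawNormal S z‖ ≠ 0 := norm_ne_zero_iff.mpr h
  have e0 : cross (pd 1 S z) (rawNormal S z) = _ := cross_cross_left (pd 0 S z) (pd 1 S z)
  have e1 : cross (rawNormal S z) (pd 0 S z) = _ := cross_cross_right (pd 0 S z) (pd 1 S z)
  rw [Matrix.inv_def, det_metric, real_inner_self_eq_norm_sq, Ring.inverse_eq_inv',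
    Matrix.adjugate_fin_two]
  fin_cases α
  · simp only [conormal, unitNormal, Fin.sum_univ_two, metric, Fin.zero_eta, Matrix.cons_val_zero,
      cross_smul_right, e0]
    simp only [Matrix.smul_apply, Matrix.of_apply, Matrix.cons_val', Matrix.cons_val_zero,
      Matrix.cons_val_one, smul_eq_mul, Matrix.cons_val_fin_one]
    simp only [smul_add, smul_sub, smul_smul]
    rw [show ∀ a b c d : E3, a = c → b = -d → a + b = c - d from
      fun a b c d h1 h2 => by rw [h1, h2, sub_eq_add_neg]]
    · congr 1; field_simp
    · rw [← neg_smul]; congr 1; field_simp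
  · simp only [conormal, unitNormal, Fin.sum_univ_two, metric, Fin.mk_one, Matrix.cons_val_one,
      Matrix.cons_val_fin_one, cross_smul_left, e1]
    simp only [Matrix.smul_apply, Matrix.of_apply, Matrix.cons_val', Matrix.cons_val_zero,
      Matrix.cons_val_one, smul_eq_mul, Matrix.cons_val_fin_one]
    simp only [smul_add, smul_sub, smul_smul]
    rw [show ∀ a b c d : E3, a = -d → b = c → a + b = c - d from
      fun a b c d h1 h2 => by rw [h1, h2, sub_eq_add_neg, add_comm]]
    · rw [← neg_smul]; congr 1; rw [real_inner_comm]; field_simp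
    · congr 1; field_simp

/-- A vector is the sum of its normal and of its tangential part. -/
theorem normal_add_tangential {S : E2 → E3} {z : E2} (h : rawNormal S z ≠ 0) (v : E3) :
    (inner ℝ v (unitNormal S z)) • unitNormal S z
      + ∑ α, ∑ β, ((metric S z)⁻¹ α β * inner ℝ v (pd α S z)) • pd β S z = v := by
  have hn : ‖rawNormal S z‖ ≠ 0 := norm_ne_zero_iff.mpr h
  have e := gram_decomposition (pd 0 S z) (pd 1 S z) v
  have k : ∀ α, ∑ β, ((metric S z)⁻¹ α β * inner ℝ v (pd α S z)) • pd β S z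
      = (inner ℝ v (pd α S z) * ‖rawNormal S z‖⁻¹) • conormal S α z := by
    intro α
    rw [← inv_metric_mul_sum h, smul_smul, mul_assoc, inv_mul_cancel₀ hn, mul_one,
      Finset.smul_sum]
    exact Finset.sum_congr rfl fun β _ => by rw [smul_smul, mul_comm]
  simp only [k, Fin.sum_univ_two]
  rw [← rawNormal, real_inner_self_eq_norm_sq] at e
  rw [← sub_eq_zero, ← smul_eq_zero_iff_right (pow_ne_zero 2 hn), smul_sub, e]
  simp only [conormal, unitNormal, Matrix.cons_val_zero, Matrix.cons_val_one, cross_smul_left,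
    cross_smul_right, inner_smul_right]
  simp only [smul_add, smul_smul]
  have c1 : ∀ r : ℝ, ‖rawNormal S z‖ ^ 2 * (r * ‖rawNormal S z‖⁻¹ * ‖rawNormal S z‖⁻¹) = r := by
    intro r; field_simp
  have c2 : ∀ r : ℝ, ‖rawNormal S z‖ ^ 2 * (‖rawNormal S z‖⁻¹ * r * ‖rawNormal S z‖⁻¹) = r := by
    intro r; field_simp
  rw [c1, c1, c2]
  abel

/-- Differentiation now falls on inner products with cross products, for which the product rule is
available. Regularity of the surface is needed near `y` because the expressions are replaced before
differentiating. -/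
theorem surfDiv_eq {S : E2 → E3} {y : E2} (hm : ∀ᶠ z in 𝓝 y, rawNormal S z ≠ 0) (u : E3 → E3) :
    surfDiv u S y = ‖rawNormal S y‖⁻¹ * ∑ α, pd α (fun z => inner ℝ (u (S z)) (conormal S α z)) y := by
  rw [surfDiv, sqrt_det_metric, one_div]
  congr 1
  refine Finset.sum_congr rfl fun α _ => ?_
  refine Filter.EventuallyEq.lineDeriv_eq ?_
  filter_upwards [hm] with z hz
  rw [← inv_metric_mul_sum hz, sqrt_det_metric, inner_smul_right, inner_sum]
  simp only [inner_smul_right]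

theorem pd_eq_fderiv {F : Type*} [NormedAddCommGroup F] [NormedSpace ℝ F] {f : E2 → F} {y : E2}
    (h : DifferentiableAt ℝ f y) (α : Fin 2) :
    pd α f y = fderiv ℝ f y (EuclideanSpace.single α 1) :=
  h.lineDeriv_eq_fderiv

theorem pd_const {F : Type*} [NormedAddCommGroup F] [NormedSpace ℝ F] (c : F) (y : E2)
    (α : Fin 2) : pd α (fun _ => c) y = 0 := by
  simp [pd, lineDeriv]

theorem pd_congr {F : Type*} [NormedAddCommGroup F] [NormedSpace ℝ F] {f g : E2 → F} {y : E2}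
    (h : f =ᶠ[𝓝 y] g) {α : Fin 2} : pd α f y = pd α g y :=
  h.lineDeriv_eq

theorem differentiableAt_cross {f g : E2 → E3} {y : E2} (hf : DifferentiableAt ℝ f y)
    (hg : DifferentiableAt ℝ g y) : DifferentiableAt ℝ (fun z => cross (f z) (g z)) y :=
  (crossL.hasFDerivAt_of_bilinear hf.hasFDerivAt hg.hasFDerivAt).differentiableAt

theorem pd_cross {f g : E2 → E3} {y : E2} (hf : DifferentiableAt ℝ f y)
    (hg : DifferentiableAt ℝ g y) (α : Fin 2) :
    pd α (fun z => cross (f z) (g z)) y = cross (f y) (pd α g y) + cross (pd α f y) (g y) := by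
  rw [pd_eq_fderiv (differentiableAt_cross hf hg), pd_eq_fderiv hf, pd_eq_fderiv hg,
    show (fun z => cross (f z) (g z)) = fun z => crossL (f z) (g z) from rfl,
    (crossL.hasFDerivAt_of_bilinear hf.hasFDerivAt hg.hasFDerivAt).fderiv]
  rfl

theorem pd_inner {f g : E2 → E3} {y : E2} (hf : DifferentiableAt ℝ f y)
    (hg : DifferentiableAt ℝ g y) (α : Fin 2) :
    pd α (fun z => inner ℝ (f z) (g z)) y
      = inner ℝ (f y) (pd α g y) + inner ℝ (pd α f y) (g y) := by
  rw [pd_eq_fderiv (hf.inner ℝ hg), pd_eq_fderiv hf, pd_eq_fderiv hg, fderiv_inner_apply ℝ hf hg]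

/-! ### Surfaces twice differentiable at a single point: Weingarten relation and mean curvature. -/

section SecondOrder

variable {S : E2 → E3} {y : E2}

theorem differentiableAt_pd (hS : ∀ᶠ z in 𝓝 y, DifferentiableAt ℝ S z)
    (h2 : DifferentiableAt ℝ (fderiv ℝ S) y) (β : Fin 2) : DifferentiableAt ℝ (pd β S) y := by
  have e : pd β S =ᶠ[𝓝 y] fun z => fderiv ℝ S z (EuclideanSpace.single β 1) := by
    filter_upwards [hS] with z hz using pd_eq_fderiv hz β
  exact (h2.clm_apply (differentiableAt_const _)).congr_of_eventuallyEq e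

/-- Symmetry of the second derivative holds at one point of twice differentiability; no continuity
of second derivatives is required. -/
theorem pd_pd_comm (hS : ∀ᶠ z in 𝓝 y, DifferentiableAt ℝ S z)
    (h2 : DifferentiableAt ℝ (fderiv ℝ S) y) (α β : Fin 2) :
    pd α (pd β S) y = pd β (pd α S) y := by
  have key : ∀ α β : Fin 2, pd α (pd β S) y
      = fderiv ℝ (fderiv ℝ S) y (EuclideanSpace.single α 1) (EuclideanSpace.single β 1) := by
    intro α β
    have e : pd β S =ᶠ[𝓝 y] fun z => fderiv ℝ S z (EuclideanSpace.single β 1) := by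
      filter_upwards [hS] with z hz using pd_eq_fderiv hz β
    rw [pd_eq_fderiv (differentiableAt_pd hS h2 β), e.fderiv_eq,
      fderiv_clm_apply h2 (differentiableAt_const _)]
    simp
  rw [key, key]
  refine second_derivative_symmetric_of_eventually (f := S) ?_ h2.hasFDerivAt _ _
  filter_upwards [hS] with z hz using hz.hasFDerivAt

theorem differentiableAt_unitNormal (hS : ∀ᶠ z in 𝓝 y, DifferentiableAt ℝ S z)
    (h2 : DifferentiableAt ℝ (fderiv ℝ S) y) (hm : rawNormal S y ≠ 0) :
    DifferentiableAt ℝ (unitNormal S) y := by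
  have h : DifferentiableAt ℝ (rawNormal S) y :=
    differentiableAt_cross (differentiableAt_pd hS h2 0) (differentiableAt_pd hS h2 1)
  exact ((h.norm ℝ hm).inv (norm_ne_zero_iff.mpr hm)).smul h

theorem differentiableAt_conormal (hS : ∀ᶠ z in 𝓝 y, DifferentiableAt ℝ S z)
    (h2 : DifferentiableAt ℝ (fderiv ℝ S) y) (hm : rawNormal S y ≠ 0) (α : Fin 2) :
    DifferentiableAt ℝ (conormal S α) y := by
  fin_cases α
  · exact differentiableAt_cross (differentiableAt_pd hS h2 1) (differentiableAt_unitNormal hS h2 hm)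
  · exact differentiableAt_cross (differentiableAt_unitNormal hS h2 hm) (differentiableAt_pd hS h2 0)

theorem inner_pd_unitNormal_self (hS : ∀ᶠ z in 𝓝 y, DifferentiableAt ℝ S z)
    (h2 : DifferentiableAt ℝ (fderiv ℝ S) y) (hm : ∀ᶠ z in 𝓝 y, rawNormal S z ≠ 0) (α : Fin 2) :
    inner ℝ (pd α (unitNormal S) y) (unitNormal S y) = 0 := by
  have hd := differentiableAt_unitNormal hS h2 hm.self_of_nhds
  have e : (fun z => inner ℝ (unitNormal S z) (unitNormal S z)) =ᶠ[𝓝 y] fun _ => (1 : ℝ) := by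
    filter_upwards [hm] with z hz using inner_unitNormal_self hz
  have h1 := pd_inner hd hd α
  rw [pd_congr e, pd_const, real_inner_comm] at h1
  linarith

/-- The Weingarten relation. -/
theorem inner_pd_pd_unitNormal (hS : ∀ᶠ z in 𝓝 y, DifferentiableAt ℝ S z)
    (h2 : DifferentiableAt ℝ (fderiv ℝ S) y) (hm : ∀ᶠ z in 𝓝 y, rawNormal S z ≠ 0) (α β : Fin 2) :
    inner ℝ (pd α (pd β S) y) (unitNormal S y) = -inner ℝ (pd β S y) (pd α (unitNormal S) y) := by
  have hd := differentiableAt_unitNormal hS h2 hm.self_of_nhds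
  have h1 := pd_inner (differentiableAt_pd hS h2 β) hd α
  have e : (fun z => inner ℝ (pd β S z) (unitNormal S z)) = fun _ => (0 : ℝ) :=
    funext fun z => inner_pd_unitNormal S z β
  rw [e, pd_const] at h1
  linarith

/-- The divergence of the conormal frame is `-2 √g H n`. -/
theorem sum_pd_conormal (hS : ∀ᶠ z in 𝓝 y, DifferentiableAt ℝ S z)
    (h2 : DifferentiableAt ℝ (fderiv ℝ S) y) (hm : ∀ᶠ z in 𝓝 y, rawNormal S z ≠ 0) :
    ∑ α, pd α (conormal S α) y
      = -(∑ α, inner ℝ (conormal S α y) (pd α (unitNormal S) y)) • unitNormal S y := by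
  have hd := differentiableAt_unitNormal hS h2 hm.self_of_nhds
  have d0 := differentiableAt_pd hS h2 0
  have d1 := differentiableAt_pd hS h2 1
  have hn := inner_unitNormal_self hm.self_of_nhds
  have e0 : pd 0 (conormal S 0) y = _ := pd_cross d1 hd 0
  have e1 : pd 1 (conormal S 1) y = _ := pd_cross hd d0 1
  -- The terms `∂₁∂₂ϑ × n` and `n × ∂₂∂₁ϑ` cancel. What remains is `∂₂ϑ × ∂₁n` and `∂₂n × ∂₁ϑ`,
  -- products of tangent vectors, hence multiples of `n`.
  rw [Fin.sum_univ_two, e0, e1, pd_pd_comm hS h2 0 1, cross_anticomm' (unitNormal S y),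
    cross_eq_smul_of_orthogonal hn (inner_pd_unitNormal S y 1)
      (inner_pd_unitNormal_self hS h2 hm 0),
    cross_eq_smul_of_orthogonal hn (inner_pd_unitNormal_self hS h2 hm 1)
      (inner_pd_unitNormal S y 0)]
  rw [show ∀ a b c : E3, a + b + (-b + c) = a + c from fun a b c => by abel, ← add_smul,
    Fin.sum_univ_two]
  congr 1
  simp only [conormal, Matrix.cons_val_zero, Matrix.cons_val_one, inner_eq_sum_three,
    cross_apply_zero, cross_apply_one, cross_apply_two]
  ring

/-- The Weingarten relation turns `b_{αβ}` into `s ∂_βϑ · ∂_α n`, and contracting with `g^{αβ}`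
produces the conormals. The sign `s` stays because `H` is taken with respect to `N`. -/
theorem two_mul_meanCurvature (hS : ∀ᶠ z in 𝓝 y, DifferentiableAt ℝ S z)
    (h2 : DifferentiableAt ℝ (fderiv ℝ S) y) (hm : ∀ᶠ z in 𝓝 y, rawNormal S z ≠ 0)
    {N : E3 → E3} {s : ℝ} (hN : N (S y) = s • unitNormal S y) :
    2 * meanCurvature N S y = s * ‖rawNormal S y‖⁻¹ *
      ∑ α, inner ℝ (conormal S α y) (pd α (unitNormal S) y) := by
  have hn : ‖rawNormal S y‖ ≠ 0 := norm_ne_zero_iff.mpr hm.self_of_nhds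
  rw [meanCurvature, ← mul_assoc, show (2 : ℝ) * (1 / 2) = 1 by norm_num, one_mul, Finset.mul_sum]
  refine Finset.sum_congr rfl fun α _ => ?_
  rw [← inv_metric_mul_sum hm.self_of_nhds, inner_smul_left, sum_inner, mul_assoc,
    conj_trivial, inv_mul_cancel_left₀ hn, Finset.mul_sum]
  refine Finset.sum_congr rfl fun β _ => ?_
  have := inner_pd_pd_unitNormal hS h2 hm α β
  rw [secondForm, Matrix.of_apply, hN, inner_smul_right, inner_smul_left, conj_trivial,
    show (fun z => pd β S z) = pd β S from rfl, this]
  ring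

end SecondOrder

/-! ### The boundary in a chart -/

/-- The inclusion `(y₁, y₂) ↦ (y₁, y₂, 0)`. -/
def flat : E2 →L[ℝ] E3 :=
  LinearMap.toContinuousLinearMap
    { toFun := fun y => !₂[y 0, y 1, 0]
      map_add' := fun x y => by apply E3.ext_three <;> simp
      map_smul' := fun c y => by apply E3.ext_three <;> simp }

theorem flat_apply (y : E2) : flat y = !₂[y 0, y 1, 0] := rfl

theorem flat_apply_two (y : E2) : flat y 2 = 0 := by simp [flat_apply]

theorem flat_single_zero : flat (EuclideanSpace.single 0 1) = EuclideanSpace.single 0 1 := by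
  apply E3.ext_three <;> simp [flat_apply]

theorem flat_single_one : flat (EuclideanSpace.single 1 1) = EuclideanSpace.single 1 1 := by
  apply E3.ext_three <;> simp [flat_apply]

theorem norm_flat (y : E2) : ‖flat y‖ = ‖y‖ := by
  rw [EuclideanSpace.norm_eq, EuclideanSpace.norm_eq, Fin.sum_univ_three, Fin.sum_univ_two]
  simp [flat_apply]

theorem flat_mem_ball {y : E2} {r : ℝ} : flat y ∈ Metric.ball (0 : E3) r ↔
    y ∈ Metric.ball (0 : E2) r := by
  rw [mem_ball_zero_iff, mem_ball_zero_iff, norm_flat]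

namespace BoundaryChart

variable {Ω : Set E3} (c : BoundaryChart 1 Ω) {y : E2}

theorem contDiffAt_toFun {p : E3} (hp : p ∈ Metric.ball (0 : E3) c.radius) :
    ContDiffAt ℝ 1 c.toFun p :=
  c.contDiffOn_toFun.contDiffAt (Metric.isOpen_ball.mem_nhds hp)

theorem hasFDerivAt_surf (hy : y ∈ Metric.ball (0 : E2) c.radius) :
    HasFDerivAt c.surf ((fderiv ℝ c.toFun (flat y)).comp flat) y :=
  HasFDerivAt.comp y
    ((c.contDiffAt_toFun (flat_mem_ball.mpr hy)).differentiableAt one_ne_zero).hasFDerivAt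
    flat.hasFDerivAt

theorem pd_surf_zero (hy : y ∈ Metric.ball (0 : E2) c.radius) :
    pd 0 c.surf y = fderiv ℝ c.toFun (flat y) (EuclideanSpace.single 0 1) := by
  rw [pd_eq_fderiv (c.hasFDerivAt_surf hy).differentiableAt, (c.hasFDerivAt_surf hy).fderiv,
    ContinuousLinearMap.comp_apply, flat_single_zero]

theorem pd_surf_one (hy : y ∈ Metric.ball (0 : E2) c.radius) :
    pd 1 c.surf y = fderiv ℝ c.toFun (flat y) (EuclideanSpace.single 1 1) := by
  rw [pd_eq_fderiv (c.hasFDerivAt_surf hy).differentiableAt, (c.hasFDerivAt_surf hy).fderiv,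
    ContinuousLinearMap.comp_apply, flat_single_one]

theorem surf_mem (hy : y ∈ Metric.ball (0 : E2) c.radius) :
    c.surf y ∈ c.target ∩ frontier Ω := by
  rw [← c.image_flat]
  exact mem_image_of_mem _ ⟨flat_mem_ball.mpr hy, flat_apply_two y⟩

theorem hasFDerivAt_invFun (hy : y ∈ Metric.ball (0 : E2) c.radius) :
    HasFDerivAt c.invFun (fderiv ℝ c.invFun (c.surf y)) (c.surf y) :=
  ((c.contDiffOn_invFun.contDiffAt (c.isOpen_target.mem_nhds (c.surf_mem hy).1)).differentiableAt
    one_ne_zero).hasFDerivAt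

theorem fderiv_invFun_fderiv_toFun (hy : y ∈ Metric.ball (0 : E2) c.radius) (v : E3) :
    fderiv ℝ c.invFun (c.surf y) (fderiv ℝ c.toFun (flat y) v) = v := by
  have hp := flat_mem_ball.mpr hy
  have h1 := (c.hasFDerivAt_invFun hy).comp (flat y)
    ((c.contDiffAt_toFun hp).differentiableAt one_ne_zero).hasFDerivAt
  have h2 : c.invFun ∘ c.toFun =ᶠ[𝓝 (flat y)] id := by
    filter_upwards [Metric.isOpen_ball.mem_nhds hp] with z hz using c.leftInvOn hz
  have := h1.unique ((hasFDerivAt_id (𝕜 := ℝ) (flat y)).congr_of_eventuallyEq h2)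
  exact DFunLike.congr_fun this v

/-- If the cross product vanished, the triple product would give a linear relation between `∂₁ϑ` and
`∂₂ϑ`; the derivative of the inverse chart carries it to one between basis vectors, forcing `∂₂ϑ =
0`, which the inverse again excludes. -/
theorem rawNormal_ne_zero (hy : y ∈ Metric.ball (0 : E2) c.radius) : rawNormal c.surf y ≠ 0 := by
  intro h
  have e := inner_cross_self (pd 0 c.surf y) (pd 1 c.surf y)
  rw [← rawNormal, h, inner_zero_left, c.pd_surf_zero hy, c.pd_surf_one hy] at e
  set T := fderiv ℝ c.toFun (flat y)
  set a := T (EuclideanSpace.single 0 1)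
  set b := T (EuclideanSpace.single 1 1)
  have ha : (inner ℝ b b) • a - (inner ℝ a b) • b = 0 := by
    rw [← cross_cross_left]
    have : cross a b = 0 := by rw [← h, rawNormal, c.pd_surf_zero hy, c.pd_surf_one hy]
    rw [this, ← crossL_apply, map_zero]
  have h1 := congrArg (fderiv ℝ c.invFun (c.surf y)) ha
  simp only [map_sub, map_smul, map_zero, a, b, T, c.fderiv_invFun_fderiv_toFun hy] at h1
  have h2 := congrArg (fun v : E3 => v 0) h1
  have hb : b = 0 := by simpa using h2
  have h3 := c.fderiv_invFun_fderiv_toFun hy (EuclideanSpace.single 1 1)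
  rw [show fderiv ℝ c.toFun (flat y) (EuclideanSpace.single 1 1) = 0 from hb, map_zero] at h3
  simpa using congrArg (fun v : E3 => v 1) h3

/-- The parametrization maps the disc into the boundary, so its derivative maps every vector of the
plane into the tangent cone of the boundary. -/
theorem inner_fderiv_surf_normal (hy : y ∈ Metric.ball (0 : E2) c.radius) {ν : E3}
    (hν : IsOutwardUnitNormal Ω (c.surf y) ν) (β : Fin 2) : inner ℝ (pd β c.surf y) ν = 0 := by
  refine hν.2.1 _ ?_
  have hd := c.hasFDerivAt_surf hy
  have h0 : (EuclideanSpace.single β 1 : E2) ∈ tangentConeAt ℝ (Metric.ball 0 c.radius) y := by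
    rw [tangentConeAt_of_mem_nhds (Metric.isOpen_ball.mem_nhds hy)]; trivial
  have h1 := (hd.hasFDerivWithinAt (s := Metric.ball 0 c.radius)).mapsTo_tangent_cone h0
  rw [pd_eq_fderiv hd.differentiableAt, hd.fderiv]
  refine tangentConeAt_mono ?_ h1
  rintro _ ⟨z, hz, rfl⟩
  exact (c.surf_mem hz).2

/-- The transversal vector `∂₃ϑ` points into the domain. -/
theorem inner_transversal_neg (hy : y ∈ Metric.ball (0 : E2) c.radius) {ν : E3}
    (hν : IsOutwardUnitNormal Ω (c.surf y) ν) :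
    inner ℝ (fderiv ℝ c.toFun (flat y) (EuclideanSpace.single 2 1)) ν < 0 := by
  set x := c.surf y
  set D := fderiv ℝ c.invFun x
  -- The third chart coordinate along the inward segment `x - tν` vanishes at `t = 0` and is
  -- positive afterwards, which gives the sign of its derivative.
  have hcurve : HasDerivAt (fun t : ℝ => c.invFun (x - t • ν) 2) (-(D ν) 2) 0 := by
    have h0 : HasDerivAt (fun t : ℝ => x - t • ν) (-ν) 0 := by
      simpa using ((hasDerivAt_id (0 : ℝ)).smul_const ν).const_sub x
    have h1 : HasFDerivAt c.invFun D (x - (0 : ℝ) • ν) := by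
      rw [zero_smul, sub_zero]; exact c.hasFDerivAt_invFun hy
    have h2 := (EuclideanSpace.proj (2 : Fin 3) : E3 →L[ℝ] ℝ).hasFDerivAt.comp_hasDerivAt
      (0 : ℝ) (h1.comp_hasDerivAt (0 : ℝ) h0)
    exact h2.congr_deriv (by simp)
  have hzero : c.invFun (x - (0 : ℝ) • ν) 2 = 0 := by
    rw [zero_smul, sub_zero]
    have := c.leftInvOn (flat_mem_ball.mpr hy)
    rw [show x = c.toFun (flat y) from rfl, this, flat_apply_two]
  have hpos : ∀ᶠ t : ℝ in 𝓝[>] 0, 0 < c.invFun (x - t • ν) 2 := by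
    have hcont : Filter.Tendsto (fun t : ℝ => x - t • ν) (𝓝[>] 0) (𝓝 x) := by
      have : Filter.Tendsto (fun t : ℝ => x - t • ν) (𝓝 0) (𝓝 (x - (0 : ℝ) • ν)) :=
        (Continuous.tendsto (by fun_prop) _)
      rw [zero_smul, sub_zero] at this
      exact this.mono_left nhdsWithin_le_nhds
    filter_upwards [hν.2.2, hcont (c.isOpen_target.mem_nhds (c.surf_mem hy).1)] with t ht ht'
    obtain ⟨p, hp, hpe⟩ := c.image_upper.symm.subset ⟨ht', ht.1⟩
    rw [show x - t • ν = c.toFun p from hpe.symm, c.leftInvOn hp.1]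
    exact hp.2
  have hle : (D ν) 2 ≤ 0 := by
    have h := (hasDerivWithinAt_iff_tendsto_slope' (s := Ioi (0 : ℝ)) (by simp)).mp
      (hcurve.hasDerivWithinAt (s := Ioi 0))
    have h' : 0 ≤ -(D ν) 2 := by
      refine ge_of_tendsto h ?_
      filter_upwards [hpos, self_mem_nhdsWithin] with t ht ht0
      rw [slope_def_field, hzero, sub_zero, sub_zero]
      exact (div_pos ht ht0).le
    linarith
  have hinj : ∀ v, D v = 0 → v = 0 := by
    have hsurj : Function.Surjective (D : E3 →ₗ[ℝ] E3) :=
      fun v => ⟨_, c.fderiv_invFun_fderiv_toFun hy v⟩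
    have := LinearMap.injective_iff_surjective.mpr hsurj
    intro v hv
    exact this (by simpa using hv)
  -- Expanding `ν` in the frame of the chart and pairing with `ν` kills the two tangential terms, so
  -- `1 = (D ν)₃ (∂₃ϑ · ν)`; as `(D ν)₃ ≤ 0`, the other factor is negative.
  have hexp : ν = fderiv ℝ c.toFun (flat y) (D ν) := by
    refine sub_eq_zero.mp (hinj _ ?_)
    rw [map_sub, c.fderiv_invFun_fderiv_toFun hy, sub_self]
  rw [E3.eq_sum_single (D ν), map_add, map_add, map_smul, map_smul, map_smul,
    ← c.pd_surf_zero hy, ← c.pd_surf_one hy] at hexp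
  have h1 : inner ℝ ν ν = (1 : ℝ) := by rw [real_inner_self_eq_norm_sq, hν.1, one_pow]
  replace hexp := congrArg (fun v => inner ℝ v ν) hexp
  simp only [h1] at hexp
  rw [inner_add_left, inner_add_left, inner_smul_left, inner_smul_left, inner_smul_left,
    c.inner_fderiv_surf_normal hy hν, c.inner_fderiv_surf_normal hy hν] at hexp
  simp only [conj_trivial, mul_zero, zero_add] at hexp
  by_contra hcon
  push Not at hcon
  nlinarith

theorem eventually_mem_ball (hy : y ∈ Metric.ball (0 : E2) c.radius) :
    ∀ᶠ z in 𝓝 y, z ∈ Metric.ball (0 : E2) c.radius :=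
  Metric.isOpen_ball.mem_nhds hy

/-- A unit normal field is locally a constant multiple of `∂₁ϑ × ∂₂ϑ / |∂₁ϑ × ∂₂ϑ|`. -/
theorem exists_normal_eq_smul (hy : y ∈ Metric.ball (0 : E2) c.radius) {N : E3 → E3}
    (hN : ∀ x ∈ frontier Ω, IsOutwardUnitNormal Ω x (N x)) :
    ∃ s : ℝ, s * s = 1 ∧ ∀ᶠ z in 𝓝 y, N (c.surf z) = s • unitNormal c.surf z := by
  have hpt : ∀ z ∈ Metric.ball (0 : E2) c.radius, ∃ s : ℝ, s * s = 1 ∧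
      N (c.surf z) = s • unitNormal c.surf z := by
    intro z hz
    have hν := hN _ (c.surf_mem hz).2
    have e := normal_add_tangential (c.rawNormal_ne_zero hz) (N (c.surf z))
    simp only [real_inner_comm (pd _ c.surf z), c.inner_fderiv_surf_normal hz hν, mul_zero,
      zero_smul, Finset.sum_const_zero, add_zero] at e
    refine ⟨_, ?_, e.symm⟩
    have h1 : inner ℝ (N (c.surf z)) (N (c.surf z)) = (1 : ℝ) := by
      rw [real_inner_self_eq_norm_sq, hν.1, one_pow]
    have h2 := congrArg (fun v => inner ℝ v (N (c.surf z))) e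
    simp only [h1, inner_smul_left, conj_trivial] at h2
    rwa [real_inner_comm (N (c.surf z)) (unitNormal c.surf z)] at h2
  -- The Jacobian determinant of the chart along the plane. It is continuous and has sign opposite
  -- to `s`, which makes `s` locally constant without any continuity of `N`.
  set d : E2 → ℝ := fun z => inner ℝ (cross (fderiv ℝ c.toFun (flat z) (EuclideanSpace.single 0 1))
    (fderiv ℝ c.toFun (flat z) (EuclideanSpace.single 1 1)))
    (fderiv ℝ c.toFun (flat z) (EuclideanSpace.single 2 1)) with hd
  have hd' : ∀ z ∈ Metric.ball (0 : E2) c.radius, ∀ s : ℝ, N (c.surf z) = s • unitNormal c.surf z →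
      s * d z < 0 := by
    intro z hz s hs
    have h := c.inner_transversal_neg hz (hN _ (c.surf_mem hz).2)
    have hn : 0 < ‖rawNormal c.surf z‖ := norm_pos_iff.mpr (c.rawNormal_ne_zero hz)
    rw [hs, unitNormal, inner_smul_right, inner_smul_right, real_inner_comm] at h
    have h' : inner ℝ (rawNormal c.surf z) (fderiv ℝ c.toFun (flat z) (EuclideanSpace.single 2 1))
        = d z := by rw [hd, rawNormal, c.pd_surf_zero hz, c.pd_surf_one hz]
    rw [h', mul_left_comm] at h
    exact neg_of_mul_neg_right h (inv_pos.mpr hn).le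
  have hT : ContinuousAt (fun z => fderiv ℝ c.toFun (flat z)) y := by
    have h1 : ContinuousAt (fderiv ℝ c.toFun) (flat y) :=
      (c.contDiffAt_toFun (flat_mem_ball.mpr hy)).continuousAt_fderiv one_ne_zero
    exact ContinuousAt.comp (f := flat) h1 flat.continuous.continuousAt
  have hcont : ContinuousAt d y := by
    have h0 : ∀ i : Fin 3, ContinuousAt
        (fun z => fderiv ℝ c.toFun (flat z) (EuclideanSpace.single i 1)) y :=
      fun i => hT.clm_apply continuousAt_const
    exact ContinuousAt.inner (𝕜 := ℝ)
      (((crossL.continuous.continuousAt.comp (h0 0)).clm_apply (h0 1) : ContinuousAt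
        (fun z => crossL _ _) y)) (h0 2)
  obtain ⟨s, hs, hsy⟩ := hpt y hy
  refine ⟨s, hs, ?_⟩
  have hsd : ∀ᶠ z in 𝓝 y, s * d z < 0 :=
    (continuousAt_const.mul hcont).eventually_lt_const (hd' y hy s hsy)
  filter_upwards [c.eventually_mem_ball hy, hsd] with z hz hsz
  obtain ⟨s', hs', hsz'⟩ := hpt z hz
  have h1 := hd' z hz s' hsz'
  rw [hsz']
  rcases mul_self_eq_mul_self_iff.mp (hs'.trans hs.symm) with h | h
  · rw [h]
  · rw [h] at h1; linarith

end BoundaryChart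

section

/-! ### The three identities -/

variable {Ω : Set E3} (c : BoundaryChart 1 Ω) {y : E2} {w : E3 → E3}

/-- Although `w` is differentiable only relative to the closure, the surface stays in the boundary,
so the chain rule gives a full derivative in the parameters. -/
theorem BoundaryChart.hasFDerivAt_comp_surf (hw : DifferentiableOn ℝ w (closure Ω))
    (hy : y ∈ Metric.ball (0 : E2) c.radius) :
    HasFDerivAt (fun z => w (c.surf z)) ((grad Ω w (c.surf y)).comp (fderiv ℝ c.surf y)) y := by
  have hx := frontier_subset_closure (c.surf_mem hy).2
  have hd := (c.hasFDerivAt_surf hy).differentiableAt.hasFDerivAt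
  refine ((hw _ hx).hasFDerivWithinAt.comp y (hd.hasFDerivWithinAt (s := Metric.ball 0 c.radius))
    fun z hz => ?_).hasFDerivAt (Metric.isOpen_ball.mem_nhds hy)
  exact frontier_subset_closure (c.surf_mem hz).2

theorem BoundaryChart.pd_comp_surf (hw : DifferentiableOn ℝ w (closure Ω))
    (hy : y ∈ Metric.ball (0 : E2) c.radius) (α : Fin 2) :
    pd α (fun z => w (c.surf z)) y = grad Ω w (c.surf y) (pd α c.surf y) := by
  have h := c.hasFDerivAt_comp_surf hw hy
  rw [pd_eq_fderiv h.differentiableAt, h.fderiv,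
    pd_eq_fderiv (c.hasFDerivAt_surf hy).differentiableAt]
  rfl

theorem BoundaryChart.pd_comp_surf_apply (hw : DifferentiableOn ℝ w (closure Ω))
    (hy : y ∈ Metric.ball (0 : E2) c.radius) (α : Fin 2) (i : Fin 3) :
    pd α (fun z => w (c.surf z) i) y = grad Ω w (c.surf y) (pd α c.surf y) i := by
  have h := c.hasFDerivAt_comp_surf hw hy
  have h1 := ((EuclideanSpace.proj i : E3 →L[ℝ] ℝ).hasFDerivAt (x := w (c.surf y))).comp y h
  have h2 : HasFDerivAt (fun z => w (c.surf z) i) _ y := h1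
  rw [pd_eq_fderiv h2.differentiableAt, h2.fderiv,
    pd_eq_fderiv (c.hasFDerivAt_surf hy).differentiableAt]
  rfl

theorem inner_clm_transpose (A : E3 →L[ℝ] E3) (ν a : E3) :
    inner ℝ (∑ i : Fin 3, inner ℝ (A (EuclideanSpace.single i 1)) ν •
      EuclideanSpace.single i (1 : ℝ)) a = inner ℝ (A a) ν := by
  simp only [inner_eq_sum_three, Fin.sum_univ_three, clm_apply_coord A a]
  simp
  ring

theorem tanProj_normalDeriv_eq (hw : DifferentiableOn ℝ w (closure Ω)) {N : E3 → E3}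
    (hN : ∀ x ∈ frontier Ω, IsOutwardUnitNormal Ω x (N x))
    (hy : y ∈ Metric.ball (0 : E2) c.radius) :
    tanProj (N (c.surf y)) (normalDeriv Ω w (N (c.surf y)) (c.surf y))
      = cross (curl Ω w (c.surf y)) (N (c.surf y)) + tanGradDot w N c.surf y := by
  obtain ⟨s, hs, hev⟩ := c.exists_normal_eq_smul hy hN
  have hNy := hev.self_of_nhds
  set A := grad Ω w (c.surf y) with hA
  set ν := N (c.surf y) with hν
  -- This is `Aᵀ ν`; its tangential part is `∇^{∂Ω} w · N`, and its normal component equals that of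
  -- `A ν`.
  set v : E3 := ∑ i : Fin 3, inner ℝ (A (EuclideanSpace.single i 1)) ν •
    EuclideanSpace.single i (1 : ℝ) with hv
  have e := normal_add_tangential (c.rawNormal_ne_zero hy) v
  have ht : tanGradDot w N c.surf y
      = ∑ α, ∑ β, ((metric c.surf y)⁻¹ α β * inner ℝ v (pd α c.surf y)) • pd β c.surf y := by
    simp only [tanGradDot, tanGrad, Finset.smul_sum, smul_smul]
    rw [Finset.sum_comm]
    refine Finset.sum_congr rfl fun α _ => ?_
    rw [Finset.sum_comm]
    refine Finset.sum_congr rfl fun β _ => ?_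
    rw [← Finset.sum_smul]
    congr 1
    rw [hv, inner_clm_transpose]
    simp only [c.pd_comp_surf_apply hw hy, Fin.sum_univ_three, inner_eq_sum_three, ← hA, ← hν]
    ring
  have hn : (inner ℝ v (unitNormal c.surf y)) • unitNormal c.surf y = (inner ℝ v ν) • ν := by
    rw [hNy, inner_smul_right, smul_smul, mul_right_comm, hs, one_mul]
  rw [ht, cross_curl, tanProj, normalDeriv, ← hA, ← hv, eq_sub_of_add_eq' e, hn, hv,
    inner_clm_transpose]
  abel

theorem divergence_eq (hw : DifferentiableOn ℝ w (closure Ω)) {N : E3 → E3}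
    (hN : ∀ x ∈ frontier Ω, IsOutwardUnitNormal Ω x (N x))
    (hy : y ∈ Metric.ball (0 : E2) c.radius) (h2 : DifferentiableAt ℝ (fderiv ℝ c.surf) y) :
    divergence Ω w (c.surf y)
      = inner ℝ (normalDeriv Ω w (N (c.surf y)) (c.surf y)) (N (c.surf y))
        + 2 * meanCurvature N c.surf y * inner ℝ (w (c.surf y)) (N (c.surf y))
        + surfDiv (fun x => tanProj (N x) (w x)) c.surf y := by
  obtain ⟨s, hs, hev⟩ := c.exists_normal_eq_smul hy hN
  have hNy := hev.self_of_nhds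
  have hS : ∀ᶠ z in 𝓝 y, DifferentiableAt ℝ c.surf z := by
    filter_upwards [c.eventually_mem_ball hy] with z hz
      using (c.hasFDerivAt_surf hz).differentiableAt
  have hm : ∀ᶠ z in 𝓝 y, rawNormal c.surf z ≠ 0 := by
    filter_upwards [c.eventually_mem_ball hy] with z hz using c.rawNormal_ne_zero hz
  have hwd := (c.hasFDerivAt_comp_surf hw hy).differentiableAt
  have hn : ‖rawNormal c.surf y‖ ≠ 0 := norm_ne_zero_iff.mpr hm.self_of_nhds
  have hpd : ∀ α, pd α (fun z => inner ℝ (tanProj (N (c.surf z)) (w (c.surf z)))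
      (conormal c.surf α z)) y = inner ℝ (w (c.surf y)) (pd α (conormal c.surf α) y)
        + inner ℝ (grad Ω w (c.surf y) (pd α c.surf y)) (conormal c.surf α y) := by
    intro α
    rw [← c.pd_comp_surf hw hy, ← pd_inner hwd (differentiableAt_conormal hS h2 hm.self_of_nhds α)]
    -- The conormals are tangent, so the normal part removed by the projection contributes nothing.
    refine pd_congr ?_
    filter_upwards [hev] with z hz
    rw [hz, tanProj, inner_sub_left, inner_smul_left, inner_smul_left,
      real_inner_comm _ (unitNormal c.surf z), inner_conormal_unitNormal, mul_zero, mul_zero,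
      sub_zero]
  have htr := trace_decomposition (grad Ω w (c.surf y)) (pd 0 c.surf y) (pd 1 c.surf y)
  rw [← rawNormal, real_inner_self_eq_norm_sq] at htr
  rw [surfDiv_eq hm, Finset.sum_congr rfl fun α _ => hpd α, Finset.sum_add_distrib, ← inner_sum,
    sum_pd_conormal hS h2 hm, two_mul_meanCurvature hS h2 hm hNy, hNy, inner_smul_right,
    inner_smul_right]
  have hdiv : divergence Ω w (c.surf y) = inner ℝ (grad Ω w (c.surf y) (unitNormal c.surf y))
      (unitNormal c.surf y) + ‖rawNormal c.surf y‖⁻¹ *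
        ∑ α, inner ℝ (grad Ω w (c.surf y) (pd α c.surf y)) (conormal c.surf α y) := by
    rw [show divergence Ω w (c.surf y)
      = ∑ i, grad Ω w (c.surf y) (EuclideanSpace.single i 1) i from rfl,
      ← mul_left_cancel_iff_of_pos (pow_pos (norm_pos_iff.mpr hm.self_of_nhds) 2), htr,
      Fin.sum_univ_two]
    simp only [conormal, unitNormal, Matrix.cons_val_zero, Matrix.cons_val_one,
      Matrix.cons_val_fin_one, cross_smul_left, cross_smul_right, inner_smul_right,
      inner_smul_left, map_smul, conj_trivial]
    field_simp
    ring
  rw [hdiv, normalDeriv, map_smul, inner_smul_left, inner_smul_right, conj_trivial]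
  -- The orientation enters only through `s²`: in `∂w/∂N · N`, and in the product of `H` with `w ·
  -- N`.
  linear_combination (-inner ℝ (grad Ω w (c.surf y) (unitNormal c.surf y)) (unitNormal c.surf y)
    - ‖rawNormal c.surf y‖⁻¹ * (∑ α, inner ℝ (conormal c.surf α y)
      (pd α (unitNormal c.surf) y)) * inner ℝ (w (c.surf y)) (unitNormal c.surf y)) * hs

theorem inner_curl_normal_eq (hw : DifferentiableOn ℝ w (closure Ω)) {N : E3 → E3}
    (hN : ∀ x ∈ frontier Ω, IsOutwardUnitNormal Ω x (N x))
    (hy : y ∈ Metric.ball (0 : E2) c.radius) (h2 : DifferentiableAt ℝ (fderiv ℝ c.surf) y) :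
    inner ℝ (curl Ω w (c.surf y)) (N (c.surf y))
      = surfDiv (fun x => cross (w x) (N x)) c.surf y := by
  obtain ⟨s, hs, hev⟩ := c.exists_normal_eq_smul hy hN
  have hS : ∀ᶠ z in 𝓝 y, DifferentiableAt ℝ c.surf z := by
    filter_upwards [c.eventually_mem_ball hy] with z hz
      using (c.hasFDerivAt_surf hz).differentiableAt
  have hm : ∀ᶠ z in 𝓝 y, rawNormal c.surf z ≠ 0 := by
    filter_upwards [c.eventually_mem_ball hy] with z hz using c.rawNormal_ne_zero hz
  have hwd := (c.hasFDerivAt_comp_surf hw hy).differentiableAt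
  -- By Lagrange's identity `(w × n) · (∂₂ϑ × n) = w · ∂₂ϑ`, since `n` is a unit vector orthogonal
  -- to `∂₂ϑ`; the other index gives `-w · ∂₁ϑ`.
  have e0 : pd 0 (fun z => inner ℝ (cross (w (c.surf z)) (N (c.surf z))) (conormal c.surf 0 z)) y
      = pd 0 (fun z => inner ℝ (w (c.surf z)) (s • pd 1 c.surf z)) y := by
    refine pd_congr ?_
    filter_upwards [hev, hm] with z hz hmz
    have h := inner_pd_unitNormal c.surf z 1
    rw [real_inner_comm] at h
    simp only [conormal, Matrix.cons_val_zero]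
    rw [hz, cross_smul_right, inner_smul_left, inner_cross_cross, inner_unitNormal_self hmz, h,
      inner_smul_right, conj_trivial]
    ring
  have e1 : pd 1 (fun z => inner ℝ (cross (w (c.surf z)) (N (c.surf z))) (conormal c.surf 1 z)) y
      = pd 1 (fun z => inner ℝ (w (c.surf z)) ((-s) • pd 0 c.surf z)) y := by
    refine pd_congr ?_
    filter_upwards [hev, hm] with z hz hmz
    have h := inner_pd_unitNormal c.surf z 0
    rw [real_inner_comm] at h
    simp only [conormal, Matrix.cons_val_one, Matrix.cons_val_fin_one]
    rw [hz, cross_smul_right, inner_smul_left, inner_cross_cross, inner_unitNormal_self hmz, h,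
      inner_smul_right, conj_trivial]
    ring
  have hsm : ∀ (t : ℝ) (α β : Fin 2), pd α (fun z => t • pd β c.surf z) y
      = t • pd α (pd β c.surf) y := by
    intro t α β
    have hd := differentiableAt_pd hS h2 β
    rw [pd_eq_fderiv (hd.fun_const_smul t), pd_eq_fderiv hd, fderiv_fun_const_smul hd]
    rfl
  rw [surfDiv_eq hm, Fin.sum_univ_two, e0, e1,
    pd_inner hwd ((differentiableAt_pd hS h2 1).fun_const_smul s),
    pd_inner hwd ((differentiableAt_pd hS h2 0).fun_const_smul (-s)),
    c.pd_comp_surf hw hy, c.pd_comp_surf hw hy, hsm, hsm, pd_pd_comm hS h2 1 0,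
    hev.self_of_nhds, unitNormal, inner_smul_right, inner_smul_right, rawNormal, inner_curl_cross]
  simp only [inner_smul_right]
  ring

end

section

/-! ### Radial functions and the regularized Newtonian kernel -/

/-- The Laplacian. -/
def lap (φ : E3 → ℝ) (z : E3) : ℝ :=
  ∑ i : Fin 3, fderiv ℝ (fun z' => fderiv ℝ φ z' (EuclideanSpace.single i 1)) z
    (EuclideanSpace.single i 1)

theorem hasFDerivAt_radial {f : ℝ → ℝ} {f' : ℝ} {x z : E3} (hf : HasDerivAt f f' (‖z - x‖ ^ 2)) :
    HasFDerivAt (fun z => f (‖z - x‖ ^ 2)) ((2 * f') • innerSL ℝ (z - x)) z := by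
  have h := hf.comp_hasFDerivAt z (((hasFDerivAt_id (𝕜 := ℝ) z).sub_const x).norm_sq)
  refine h.congr_fderiv ?_
  ext v
  simp
  ring

/-- Using the squared distance `t` as variable avoids the singularity of the norm at the centre; in
these terms the Laplacian on `ℝ³` is `4 t f'' + 6 f'`. -/
theorem lap_radial {f f' f'' : ℝ → ℝ} (hf : ∀ t, 0 ≤ t → HasDerivAt f (f' t) t)
    (hf' : ∀ t, 0 ≤ t → HasDerivAt f' (f'' t) t) (x z : E3) :
    lap (fun z => f (‖z - x‖ ^ 2)) z = 4 * ‖z - x‖ ^ 2 * f'' (‖z - x‖ ^ 2)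
      + 6 * f' (‖z - x‖ ^ 2) := by
  have h1 : ∀ i : Fin 3, (fun z' => fderiv ℝ (fun z => f (‖z - x‖ ^ 2)) z'
      (EuclideanSpace.single i 1)) = fun z' => f' (‖z' - x‖ ^ 2) * (2 * (z' i - x i)) := by
    intro i
    funext z'
    rw [(hasFDerivAt_radial (hf _ (sq_nonneg _))).fderiv]
    simp [EuclideanSpace.inner_single_right]
    ring
  have h2 : ∀ i : Fin 3, fderiv ℝ (fun z' => f' (‖z' - x‖ ^ 2) * (2 * (z' i - x i))) z
      (EuclideanSpace.single i 1) = 4 * (z i - x i) ^ 2 * f'' (‖z - x‖ ^ 2)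
        + 2 * f' (‖z - x‖ ^ 2) := by
    intro i
    have hp : HasFDerivAt (fun z' : E3 => 2 * (z' i - x i))
        ((2 : ℝ) • (EuclideanSpace.proj i : E3 →L[ℝ] ℝ)) z :=
      (((EuclideanSpace.proj i : E3 →L[ℝ] ℝ).hasFDerivAt (x := z)).sub_const (x i)).const_mul 2
    rw [((hasFDerivAt_radial (x := x) (hf' _ (sq_nonneg _))).fun_mul hp).fderiv]
    simp [EuclideanSpace.inner_single_right]
    ring
  have h3 : ‖z - x‖ ^ 2 = (z 0 - x 0) ^ 2 + (z 1 - x 1) ^ 2 + (z 2 - x 2) ^ 2 := by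
    rw [EuclideanSpace.real_norm_sq_eq, Fin.sum_univ_three]; simp
  rw [lap, Finset.sum_congr rfl fun i _ => by rw [h1 i, h2 i], Fin.sum_univ_three]
  linear_combination (-4 * f'' (‖z - x‖ ^ 2)) * h3

/-- A smooth function equal to `1` for `t ≤ a` and to `0` for `t ≥ 2 a`. -/
def cutoff (a t : ℝ) : ℝ := Real.smoothTransition (2 - t / a)

theorem contDiff_cutoff (a : ℝ) : ContDiff ℝ ∞ (cutoff a) :=
  Real.smoothTransition.contDiff.comp (contDiff_const.sub (contDiff_id.div_const a))

theorem cutoff_nonneg (a t : ℝ) : 0 ≤ cutoff a t := Real.smoothTransition.nonneg _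

theorem cutoff_le_one (a t : ℝ) : cutoff a t ≤ 1 := Real.smoothTransition.le_one _

variable {a : ℝ}

theorem cutoff_eq_one (ha : 0 < a) {t : ℝ} (ht : t ≤ a) : cutoff a t = 1 :=
  Real.smoothTransition.one_of_one_le (by
    have : t / a ≤ 1 := (div_le_one ha).mpr ht
    linarith)

theorem cutoff_eq_zero (ha : 0 < a) {t : ℝ} (ht : 2 * a ≤ t) : cutoff a t = 0 :=
  Real.smoothTransition.zero_of_nonpos (by
    have : 2 ≤ t / a := (le_div_iff₀ ha).mpr ht
    linarith)

theorem deriv_cutoff_eq_zero (ha : 0 < a) {t : ℝ} (ht : t < a) : deriv (cutoff a) t = 0 := by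
  have e : cutoff a =ᶠ[𝓝 t] fun _ => 1 := by
    filter_upwards [eventually_lt_nhds ht] with s hs using cutoff_eq_one ha hs.le
  rw [e.deriv_eq, deriv_const]

theorem contDiff_deriv_cutoff (a : ℝ) : ContDiff ℝ ∞ (deriv (cutoff a)) :=
  ((contDiff_infty_iff_deriv (f := cutoff a)).mp (contDiff_cutoff a)).2

theorem contDiff_deriv_deriv_cutoff (a : ℝ) : ContDiff ℝ ∞ (deriv (deriv (cutoff a))) :=
  ((contDiff_infty_iff_deriv (f := deriv (cutoff a))).mp (contDiff_deriv_cutoff a)).2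

theorem hasDerivAt_cutoff (a t : ℝ) : HasDerivAt (cutoff a) (deriv (cutoff a) t) t :=
  ((contDiff_cutoff a).differentiable (by simp) t).hasDerivAt

theorem hasDerivAt_deriv_cutoff (a t : ℝ) :
    HasDerivAt (deriv (cutoff a)) (deriv (deriv (cutoff a)) t) t :=
  ((contDiff_deriv_cutoff a).differentiable (by simp) t).hasDerivAt

theorem deriv_cutoff_eq_zero' (ha : 0 < a) {t : ℝ} (ht : 2 * a < t) : deriv (cutoff a) t = 0 := by
  have e : cutoff a =ᶠ[𝓝 t] fun _ => 0 := by
    filter_upwards [eventually_gt_nhds ht] with s hs using cutoff_eq_zero ha (le_of_lt hs)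
  rw [e.deriv_eq, deriv_const]

theorem hasCompactSupport_deriv_cutoff (ha : 0 < a) : HasCompactSupport (deriv (cutoff a)) := by
  refine HasCompactSupport.intro (isCompact_Icc (a := a) (b := 2 * a)) fun t ht => ?_
  rw [mem_Icc, not_and_or, not_le, not_le] at ht
  exact ht.elim (deriv_cutoff_eq_zero ha) (deriv_cutoff_eq_zero' ha)

/-- The function `(t + ε²)^{-1/2}`. -/
def invRoot (ε t : ℝ) : ℝ := (√(t + ε ^ 2))⁻¹

theorem invRoot_nonneg (ε t : ℝ) : 0 ≤ invRoot ε t := inv_nonneg.mpr (Real.sqrt_nonneg _)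

theorem invRoot_sq_mul {ε t : ℝ} (h : 0 < t + ε ^ 2) : invRoot ε t ^ 2 * (t + ε ^ 2) = 1 := by
  rw [invRoot, inv_pow, Real.sq_sqrt h.le, inv_mul_cancel₀ h.ne']

theorem hasDerivAt_invRoot {ε t : ℝ} (h : 0 < t + ε ^ 2) :
    HasDerivAt (invRoot ε) (-(1 / 2) * invRoot ε t ^ 3) t := by
  have h1 := (((hasDerivAt_id t).add_const (ε ^ 2)).sqrt h.ne').inv (Real.sqrt_pos.mpr h).ne'
  refine h1.congr_deriv ?_
  simp only [invRoot, id]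
  have : √(t + ε ^ 2) ≠ 0 := (Real.sqrt_pos.mpr h).ne'
  field_simp

/-- The part of the Laplacian of the truncated kernel that comes from the truncation. -/
def remainder (a ε t : ℝ) : ℝ :=
  (4 * t * deriv (deriv (cutoff a)) t + 6 * deriv (cutoff a) t) * invRoot ε t
    - 4 * t * deriv (cutoff a) t * invRoot ε t ^ 3

/-- For `q = (t + ε²)^{-1/2}` one has `4 t q'' + 6 q' = 3 q⁵ (t - (t + ε²)) = -3 ε² q⁵`: a peak that
concentrates at the centre as `ε → 0`. Every term in which the cutoff is differentiated goes into
`remainder`. -/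
theorem lap_truncated {ε : ℝ} (hε : 0 < ε) (a : ℝ) (x z : E3) :
    lap (fun z => cutoff a (‖z - x‖ ^ 2) * invRoot ε (‖z - x‖ ^ 2)) z =
      remainder a ε (‖z - x‖ ^ 2)
        - 3 * ε ^ 2 * invRoot ε (‖z - x‖ ^ 2) ^ 5 * cutoff a (‖z - x‖ ^ 2) := by
  have hpos : ∀ t : ℝ, 0 ≤ t → 0 < t + ε ^ 2 := fun t ht => by positivity
  have h := lap_radial (f := fun t => cutoff a t * invRoot ε t)
    (fun t ht => (hasDerivAt_cutoff a t).mul (hasDerivAt_invRoot (hpos t ht)))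
    (fun t ht => ((hasDerivAt_deriv_cutoff a t).mul (hasDerivAt_invRoot (hpos t ht))).add
      ((hasDerivAt_cutoff a t).mul (((hasDerivAt_invRoot (hpos t ht)).pow 3).const_mul (-(1 / 2)))))
    x z
  rw [h, remainder]
  have e := invRoot_sq_mul (hpos _ (sq_nonneg ‖z - x‖))
  norm_num
  linear_combination (3 * cutoff a (‖z - x‖ ^ 2) * invRoot ε (‖z - x‖ ^ 2) ^ 3) * e

theorem contDiff_truncated {ε : ℝ} (hε : 0 < ε) (a : ℝ) (x : E3) :
    ContDiff ℝ ∞ (fun z => cutoff a (‖z - x‖ ^ 2) * invRoot ε (‖z - x‖ ^ 2)) := by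
  have h : ContDiff ℝ ∞ (fun z : E3 => ‖z - x‖ ^ 2) :=
    (contDiff_norm_sq ℝ).comp (contDiff_id.sub contDiff_const)
  refine ((contDiff_cutoff a).comp h).mul ?_
  have hp : ∀ z : E3, ‖z - x‖ ^ 2 + ε ^ 2 ≠ 0 := fun z => by positivity
  exact ((h.add contDiff_const).sqrt hp).inv fun z =>
    (Real.sqrt_pos.mpr (by positivity)).ne'

/-- The cutoff acts on the squared distance, whence the radius `√(2a)`. -/
theorem tsupport_truncated_subset (ha : 0 < a) (g : E3 → ℝ) (x : E3) :
    tsupport (fun z => cutoff a (‖z - x‖ ^ 2) * g z) ⊆ Metric.closedBall x (√(2 * a)) := by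
  refine closure_minimal (fun z hz => ?_) Metric.isClosed_closedBall
  rw [Function.mem_support] at hz
  rw [Metric.mem_closedBall, dist_eq_norm]
  refine Real.le_sqrt_of_sq_le (not_lt.mp fun hcon => ?_)
  exact hz (by rw [cutoff_eq_zero ha hcon.le, zero_mul])

end

section

/-! ### The representation formula -/

variable {a : ℝ}

theorem invRoot_zero_sq (v : E3) : invRoot 0 (‖v‖ ^ 2) = ‖v‖⁻¹ := by
  simp [invRoot]

theorem invRoot_le_of_le {ε s t : ℝ} (hs : 0 < s) (hst : s ≤ t) : invRoot ε t ≤ (√s)⁻¹ :=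
  inv_anti₀ (Real.sqrt_pos.mpr hs) (Real.sqrt_le_sqrt (by nlinarith [sq_nonneg ε]))

theorem invRoot_le_inv_norm (ε : ℝ) {v : E3} (hv : v ≠ 0) : invRoot ε (‖v‖ ^ 2) ≤ ‖v‖⁻¹ := by
  have := invRoot_le_of_le (ε := ε) (pow_pos (norm_pos_iff.mpr hv) 2) le_rfl
  rwa [Real.sqrt_sq (norm_nonneg _)] at this

theorem tendsto_invRoot {t : ℝ} (ht : 0 < t) :
    Filter.Tendsto (fun c : ℝ => invRoot c⁻¹ t) Filter.atTop (𝓝 (invRoot 0 t)) := by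
  have h : ContinuousAt (fun ε : ℝ => invRoot ε t) 0 := by
    have h1 : ContinuousAt (fun ε : ℝ => √(t + ε ^ 2)) 0 := by fun_prop
    exact h1.inv₀ (by simpa using (Real.sqrt_pos.mpr ht).ne')
  exact h.tendsto.comp tendsto_inv_atTop_zero

/-- Derivatives of the cutoff vanish for `t < a`, where the kernel may blow up; for `t ≥ a` the
kernel is at most `a^{-1/2}` whatever `ε` is. -/
theorem exists_bound_remainder (ha : 0 < a) :
    ∃ C, ∀ ε t : ℝ, |remainder a ε t| ≤ C := by
  have hc1 := (contDiff_deriv_cutoff a).continuous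
  have hc2 := (contDiff_deriv_deriv_cutoff a).continuous
  have hs1 := hasCompactSupport_deriv_cutoff ha
  have hs2 : HasCompactSupport (deriv (deriv (cutoff a))) := hs1.deriv
  obtain ⟨C1, h1⟩ := (((continuous_const.mul continuous_id).mul hc2).bounded_above_of_compact_support
    hs2.mul_left : ∃ C, ∀ t, ‖(4 : ℝ) * t * deriv (deriv (cutoff a)) t‖ ≤ C)
  obtain ⟨C2, h2⟩ := ((continuous_const.mul hc1).bounded_above_of_compact_support
    hs1.mul_left : ∃ C, ∀ t, ‖(6 : ℝ) * deriv (cutoff a) t‖ ≤ C)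
  obtain ⟨C3, h3⟩ := (((continuous_const.mul continuous_id).mul hc1).bounded_above_of_compact_support
    hs1.mul_left : ∃ C, ∀ t, ‖(4 : ℝ) * t * deriv (cutoff a) t‖ ≤ C)
  have hC1 : 0 ≤ C1 := (norm_nonneg _).trans (h1 0)
  have hC2 : 0 ≤ C2 := (norm_nonneg _).trans (h2 0)
  have hC3 : 0 ≤ C3 := (norm_nonneg _).trans (h3 0)
  refine ⟨(C1 + C2) * (√a)⁻¹ + C3 * (√a)⁻¹ ^ 3, fun ε t => ?_⟩
  rcases lt_or_ge t a with ht | ht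
  · have e1 := deriv_cutoff_eq_zero ha ht
    have e2 : deriv (deriv (cutoff a)) t = 0 := by
      have e : deriv (cutoff a) =ᶠ[𝓝 t] fun _ => 0 := by
        filter_upwards [eventually_lt_nhds ht] with s hs using deriv_cutoff_eq_zero ha hs
      rw [e.deriv_eq, deriv_const]
    rw [remainder, e1, e2]
    simp only [mul_zero, add_zero, zero_mul, sub_zero, abs_zero]
    positivity
  · have hq := invRoot_le_of_le (ε := ε) ha ht
    have hq0 := invRoot_nonneg ε t
    refine (abs_sub _ _).trans (add_le_add ?_ ?_)
    · rw [abs_mul, abs_of_nonneg hq0]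
      exact mul_le_mul ((abs_add_le _ _).trans (add_le_add (h1 t) (h2 t))) hq hq0 (by positivity)
    · rw [abs_mul, abs_of_nonneg (pow_nonneg hq0 3)]
      exact mul_le_mul (h3 t) (pow_le_pow_left₀ hq0 hq 3) (by positivity) hC3

theorem tendsto_remainder (ha : 0 < a) (t : ℝ) :
    Filter.Tendsto (fun c : ℝ => remainder a c⁻¹ t) Filter.atTop (𝓝 (remainder a 0 t)) := by
  rcases lt_or_ge t a with ht | ht
  · have e1 := deriv_cutoff_eq_zero ha ht
    have e2 : deriv (deriv (cutoff a)) t = 0 := by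
      have e : deriv (cutoff a) =ᶠ[𝓝 t] fun _ => 0 := by
        filter_upwards [eventually_lt_nhds ht] with s hs using deriv_cutoff_eq_zero ha hs
      rw [e.deriv_eq, deriv_const]
    simp only [remainder, e1, e2, mul_zero, add_zero, zero_mul, sub_zero]
    exact tendsto_const_nhds
  · have h := tendsto_invRoot (ha.trans_le ht)
    exact (h.const_mul _).sub ((h.pow 3).const_mul _)

theorem continuous_invRoot_comp {ε : ℝ} (hε : 0 < ε) (x : E3) :
    Continuous fun z : E3 => invRoot ε (‖z - x‖ ^ 2) := by
  have h : Continuous fun z : E3 => √(‖z - x‖ ^ 2 + ε ^ 2) := by fun_prop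
  exact h.inv₀ fun z => (Real.sqrt_pos.mpr (by positivity)).ne'

theorem continuous_remainder_comp {ε : ℝ} (hε : 0 < ε) (a : ℝ) (x : E3) :
    Continuous fun z : E3 => remainder a ε (‖z - x‖ ^ 2) := by
  have hc1 := (contDiff_deriv_cutoff a).continuous
  have hc2 := (contDiff_deriv_deriv_cutoff a).continuous
  have hr := continuous_invRoot_comp hε x
  have hn : Continuous fun z : E3 => ‖z - x‖ ^ 2 := by fun_prop
  exact ((((continuous_const.mul hn).mul (hc2.comp hn)).add
    (continuous_const.mul (hc1.comp hn))).mul hr).sub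
      (((continuous_const.mul hn).mul (hc1.comp hn)).mul (hr.pow 3))

/-- The Newtonian kernel, truncated. -/
def newton (a : ℝ) (v : E3) : ℝ := cutoff a (‖v‖ ^ 2) * ‖v‖⁻¹

/-- The Laplacian of the truncated Newtonian kernel, away from the origin. -/
def newtonRem (a : ℝ) (v : E3) : ℝ := remainder a 0 (‖v‖ ^ 2)

theorem integrable_peak : Integrable (fun ξ : E3 => invRoot 1 (‖ξ‖ ^ 2) ^ 5) := by
  have h := integrable_rpow_neg_one_add_norm_sq (E := E3) (μ := volume) (r := 5)
    (by rw [finrank_euclideanSpace_fin]; norm_num)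
  refine h.congr (Filter.Eventually.of_forall fun ξ => ?_)
  have hp : (0 : ℝ) ≤ 1 + ‖ξ‖ ^ 2 := by positivity
  simp only [invRoot]
  rw [one_pow, add_comm (‖ξ‖ ^ 2), inv_pow, Real.sqrt_eq_rpow,
    ← Real.rpow_natCast (((1 : ℝ) + ‖ξ‖ ^ 2) ^ ((1 : ℝ) / 2)), ← Real.rpow_mul hp,
    ← Real.rpow_neg hp]
  norm_num

/-- The constant in the representation formula. -/
def newtonConst : ℝ := ∫ ξ : E3, 3 * invRoot 1 (‖ξ‖ ^ 2) ^ 5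

/-- The constant equals `4π`, but only its positivity matters, in order to divide by it. -/
theorem newtonConst_pos : 0 < newtonConst := by
  have hpos : ∀ ξ : E3, 0 < 3 * invRoot 1 (‖ξ‖ ^ 2) ^ 5 := fun ξ => by
    have : 0 < invRoot 1 (‖ξ‖ ^ 2) := inv_pos.mpr (Real.sqrt_pos.mpr (by positivity))
    positivity
  rw [newtonConst, integral_pos_iff_support_of_nonneg (fun ξ => (hpos ξ).le)
    (integrable_peak.const_mul 3)]
  have : Function.support (fun ξ : E3 => 3 * invRoot 1 (‖ξ‖ ^ 2) ^ 5) = univ :=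
    eq_univ_of_forall fun ξ => (hpos ξ).ne'
  rw [this]
  exact Measure.measure_univ_pos.mpr (NeZero.ne _)

theorem invRoot_scale {c : ℝ} (hc : 0 < c) (s : ℝ) :
    invRoot 1 (c ^ 2 * s) = c⁻¹ * invRoot c⁻¹ s := by
  have : c ^ 2 * s + 1 ^ 2 = c ^ 2 * (s + c⁻¹ ^ 2) := by field_simp
  rw [invRoot, this, Real.sqrt_mul (sq_nonneg c), Real.sqrt_sq hc.le, mul_inv, invRoot]

/-- With `ε = 1/c` the peak is `c³` times a fixed integrable profile evaluated at `c (z - x)`, that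
is, an approximate identity up to `newtonConst`. -/
theorem tendsto_peak {g : E3 → ℝ} (hg : Integrable g) {x : E3} (hx : ContinuousAt g x) :
    Filter.Tendsto (fun c : ℝ => ∫ z, 3 * c⁻¹ ^ 2 * invRoot c⁻¹ (‖z - x‖ ^ 2) ^ 5 * g z)
      Filter.atTop (𝓝 (newtonConst * g x)) := by
  have h0 : ∀ ξ : E3, 0 ≤ newtonConst⁻¹ * (3 * invRoot 1 (‖ξ‖ ^ 2) ^ 5) := fun ξ => by
    have := invRoot_nonneg 1 (‖ξ‖ ^ 2)
    have := newtonConst_pos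
    positivity
  have h1 : ∫ ξ : E3, newtonConst⁻¹ * (3 * invRoot 1 (‖ξ‖ ^ 2) ^ 5) = 1 := by
    rw [integral_const_mul]
    exact inv_mul_cancel₀ newtonConst_pos.ne'
  have h2 : Filter.Tendsto (fun ξ : E3 => ‖ξ‖ ^ Module.finrank ℝ E3 *
      (newtonConst⁻¹ * (3 * invRoot 1 (‖ξ‖ ^ 2) ^ 5))) (Bornology.cobounded E3) (𝓝 0) := by
    rw [finrank_euclideanSpace_fin]
    have hb : Filter.Tendsto (fun ξ : E3 => newtonConst⁻¹ * 3 * (‖ξ‖ ^ 2)⁻¹)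
        (Bornology.cobounded E3) (𝓝 0) := by
      have := (tendsto_inv_atTop_zero.comp ((Filter.tendsto_pow_atTop (two_ne_zero)).comp
        (tendsto_norm_cobounded_atTop (E := E3)))).const_mul (newtonConst⁻¹ * 3)
      simpa using this
    refine squeeze_zero' (Filter.Eventually.of_forall fun ξ => mul_nonneg (by positivity) (h0 ξ))
      ?_ hb
    filter_upwards [Bornology.isBounded_def.mp (Bornology.isBounded_singleton (x := (0 : E3)))]
      with ξ hξ
    have hq := invRoot_le_inv_norm 1 (show ξ ≠ 0 from hξ)
    have hn : 0 < ‖ξ‖ := norm_pos_iff.mpr hξ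
    have h5 := pow_le_pow_left₀ (invRoot_nonneg _ _) hq 5
    have hk := newtonConst_pos
    calc ‖ξ‖ ^ 3 * (newtonConst⁻¹ * (3 * invRoot 1 (‖ξ‖ ^ 2) ^ 5))
        ≤ ‖ξ‖ ^ 3 * (newtonConst⁻¹ * (3 * ‖ξ‖⁻¹ ^ 5)) := by gcongr
      _ = newtonConst⁻¹ * 3 * (‖ξ‖ ^ 2)⁻¹ := by field_simp
  have h3 := (tendsto_integral_comp_smul_smul_of_integrable' h0 h1 h2 hg hx).const_mul newtonConst
  refine h3.congr' ?_
  filter_upwards [Filter.eventually_gt_atTop 0] with c hc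
  rw [← integral_const_mul]
  refine integral_congr_ae (Filter.Eventually.of_forall fun z => ?_)
  have hk := newtonConst_pos.ne'
  simp only [finrank_euclideanSpace_fin, smul_eq_mul, norm_smul, Real.norm_eq_abs, abs_of_pos hc,
    mul_pow, invRoot_scale hc, norm_sub_rev x z]
  field_simp

/-- `L` is the weak Laplacian of `u` on `O`. -/
def HasWeakLap (O : Set E3) (u L : E3 → ℝ) : Prop :=
  ∀ φ : E3 → ℝ, ContDiff ℝ ∞ φ → HasCompactSupport φ → tsupport φ ⊆ O →
    ∫ z, u z * lap φ z = ∫ z, L z * φ z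

end

/-! ### Removing the regularization of the kernel. -/

section

variable {a : ℝ}

theorem measurable_newton (a : ℝ) : Measurable (newton a) :=
  ((contDiff_cutoff a).continuous.measurable.comp (measurable_norm.pow_const 2)).mul
    measurable_norm.inv

theorem abs_newton_le (a : ℝ) (v : E3) : |newton a v| ≤ ‖v‖⁻¹ := by
  rw [newton, abs_mul, abs_of_nonneg (cutoff_nonneg _ _), abs_of_nonneg (by positivity)]
  exact mul_le_of_le_one_left (by positivity) (cutoff_le_one _ _)

/-- The square has a singularity `|v|⁻²`, integrable in dimension three. The pairing with an `L²`
density is therefore finite at every base point. -/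
theorem memLp_newton (ha : 0 < a) : MemLp (newton a) 2 volume := by
  rw [memLp_two_iff_integrable_sq (measurable_newton a).aestronglyMeasurable]
  rw [← integrableOn_iff_integrable_of_support_subset (s := Metric.ball (0 : E3) (√(2 * a) + 1))]
  · refine integrableOn_ball_of_norm_le_rpow (C := 1) (α := 2)
      (by rw [finrank_euclideanSpace_fin]; norm_num) (by rw [finrank_euclideanSpace_fin]; norm_num)
      (Filter.Eventually.of_forall fun v => ?_)
      ((measurable_newton a).pow_const 2).aestronglyMeasurable
    rw [one_mul, Real.rpow_neg (norm_nonneg _), Real.rpow_two, norm_pow, Real.norm_eq_abs,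
      ← inv_pow]
    exact pow_le_pow_left₀ (abs_nonneg _) (abs_newton_le a v) 2
  · intro v hv
    rw [mem_ball_zero_iff]
    by_contra hcon
    refine hv ?_
    have h : 2 * a ≤ ‖v‖ ^ 2 := by
      have h1 : √(2 * a) ≤ ‖v‖ := by linarith
      calc 2 * a = √(2 * a) ^ 2 := (Real.sq_sqrt (by positivity)).symm
        _ ≤ _ := pow_le_pow_left₀ (Real.sqrt_nonneg _) h1 2
    simp [newton, cutoff_eq_zero ha h]

theorem integrable_mul_newton {L : E3 → ℝ} (hL : MemLp L 2 volume) (ha : 0 < a) (x : E3) :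
    Integrable fun z => L z * newton a (z - x) :=
  hL.integrable_mul ((memLp_newton ha).comp_measurePreserving
    (measurePreserving_sub_right volume x))

theorem tendsto_integral_newton {L : E3 → ℝ} (hL : MemLp L 2 volume) (ha : 0 < a) (x : E3) :
    Filter.Tendsto (fun c : ℝ => ∫ z, L z *
      (cutoff a (‖z - x‖ ^ 2) * invRoot c⁻¹ (‖z - x‖ ^ 2))) Filter.atTop
      (𝓝 (∫ z, L z * newton a (z - x))) := by
  have hne : ∀ᵐ z : E3, z ≠ x := by
    simp [ae_iff, measure_singleton]
  refine tendsto_integral_filter_of_dominated_convergence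
    (fun z => ‖L z * newton a (z - x)‖) ?_ ?_ (integrable_mul_newton hL ha x).norm ?_
  · filter_upwards [Filter.eventually_gt_atTop 0] with c hc
    exact hL.1.mul (contDiff_truncated (inv_pos.mpr hc) a x).continuous.aestronglyMeasurable
  · refine Filter.Eventually.of_forall fun c => ?_
    filter_upwards [hne] with z hz
    rw [norm_mul, norm_mul, newton, norm_mul, norm_mul]
    gcongr
    rw [Real.norm_of_nonneg (invRoot_nonneg _ _), Real.norm_of_nonneg (by positivity)]
    exact invRoot_le_inv_norm _ (sub_ne_zero.mpr hz)
  · filter_upwards [hne] with z hz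
    have h := tendsto_invRoot (pow_pos (norm_pos_iff.mpr (sub_ne_zero.mpr hz)) 2)
    rw [invRoot_zero_sq] at h
    exact (h.const_mul _).const_mul _

theorem tendsto_integral_remainder {u : E3 → ℝ} (hu : Integrable u) (ha : 0 < a) (x : E3) :
    Filter.Tendsto (fun c : ℝ => ∫ z, u z * remainder a c⁻¹ (‖z - x‖ ^ 2)) Filter.atTop
      (𝓝 (∫ z, u z * newtonRem a (z - x))) := by
  obtain ⟨C, hC⟩ := exists_bound_remainder ha
  refine tendsto_integral_filter_of_dominated_convergence (fun z => ‖u z‖ * C) ?_ ?_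
    (hu.norm.mul_const C) ?_
  · filter_upwards [Filter.eventually_gt_atTop 0] with c hc
    exact hu.1.mul (continuous_remainder_comp (inv_pos.mpr hc) a x).aestronglyMeasurable
  · refine Filter.Eventually.of_forall fun c => Filter.Eventually.of_forall fun z => ?_
    rw [norm_mul]
    gcongr
    exact hC _ _
  · exact Filter.Eventually.of_forall fun z => (tendsto_remainder ha _).const_mul _

/-- The Newtonian representation of a function with square integrable weak Laplacian. -/
theorem newton_representation {u L : E3 → ℝ} {O : Set E3} (hu : Integrable u)
    (hL : MemLp L 2 volume) (hw : HasWeakLap O u L) (ha : 0 < a) {x : E3}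
    (hx : Metric.closedBall x (√(2 * a)) ⊆ O) (hux : ContinuousAt u x) :
    newtonConst * u x = (∫ z, u z * newtonRem a (z - x)) - ∫ z, L z * newton a (z - x) := by
  obtain ⟨C, hC⟩ := exists_bound_remainder ha
  have hcut : Continuous fun z : E3 => cutoff a (‖z - x‖ ^ 2) :=
    (contDiff_cutoff a).continuous.comp (by fun_prop)
  have hg : Integrable fun z => u z * cutoff a (‖z - x‖ ^ 2) :=
    hu.mul_bdd (c := 1) hcut.aestronglyMeasurable (Filter.Eventually.of_forall fun z => by
      rw [Real.norm_of_nonneg (cutoff_nonneg _ _)]; exact cutoff_le_one _ _)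
  have hpeak := tendsto_peak hg (hux.mul hcut.continuousAt)
  rw [sub_self, norm_zero, zero_pow two_ne_zero, cutoff_eq_one ha ha.le, mul_one] at hpeak
  have hlim := (tendsto_integral_remainder hu ha x).sub (tendsto_integral_newton hL ha x)
  refine tendsto_nhds_unique hpeak (hlim.congr' ?_)
  filter_upwards [Filter.eventually_gt_atTop 0] with c hc
  have hε := inv_pos.mpr hc
  have hts := tsupport_truncated_subset ha (fun z => invRoot c⁻¹ (‖z - x‖ ^ 2)) x
  -- Testing the weak Laplacian against the truncated kernel gives the formula exactly for each `ε`,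
  -- with the peak integral in place of the value at `x`.
  rw [← hw _ (contDiff_truncated hε a x)
    ((isCompact_closedBall x _).of_isClosed_subset (isClosed_tsupport _) hts) (hts.trans hx)]
  have hi1 : Integrable fun z => u z * remainder a c⁻¹ (‖z - x‖ ^ 2) :=
    hu.mul_bdd (continuous_remainder_comp hε a x).aestronglyMeasurable
      (Filter.Eventually.of_forall fun z => hC _ _)
  have hi2 : Integrable fun z => u z * lap (fun z => cutoff a (‖z - x‖ ^ 2) *
      invRoot c⁻¹ (‖z - x‖ ^ 2)) z := by
    simp only [lap_truncated hε]
    have hq : Continuous fun z : E3 => 3 * c⁻¹ ^ 2 * invRoot c⁻¹ (‖z - x‖ ^ 2) ^ 5 :=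
      continuous_const.mul ((continuous_invRoot_comp hε x).pow 5)
    have hi3 := hg.mul_bdd (c := 3 * c⁻¹ ^ 2 * (√(c⁻¹ ^ 2))⁻¹ ^ 5) hq.aestronglyMeasurable
      (Filter.Eventually.of_forall fun z => by
        have h0 := invRoot_nonneg c⁻¹ (‖z - x‖ ^ 2)
        rw [Real.norm_of_nonneg (by positivity)]
        gcongr
        exact inv_anti₀ (Real.sqrt_pos.mpr (by positivity))
          (Real.sqrt_le_sqrt (by nlinarith [sq_nonneg ‖z - x‖])))
    refine (hi1.sub hi3).congr (Filter.Eventually.of_forall fun z => ?_)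
    simp only [Pi.sub_apply]
    ring
  rw [← integral_sub hi1 hi2]
  refine integral_congr_ae (Filter.Eventually.of_forall fun z => ?_)
  simp only [lap_truncated hε]
  ring

theorem newtonRem_eq_zero_of_lt (ha : 0 < a) {v : E3} (hv : ‖v‖ ^ 2 < a) : newtonRem a v = 0 := by
  have e2 : deriv (deriv (cutoff a)) (‖v‖ ^ 2) = 0 := by
    have e : deriv (cutoff a) =ᶠ[𝓝 (‖v‖ ^ 2)] fun _ => 0 := by
      filter_upwards [eventually_lt_nhds hv] with s hs using deriv_cutoff_eq_zero ha hs
    rw [e.deriv_eq, deriv_const]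
  simp [newtonRem, remainder, e2, deriv_cutoff_eq_zero ha hv]

theorem contDiff_newtonRem (ha : 0 < a) : ContDiff ℝ 1 (newtonRem a) := by
  rw [contDiff_iff_contDiffAt]
  intro v
  rcases lt_or_ge (‖v‖ ^ 2) a with hv | hv
  · have hc : ContinuousAt (fun v : E3 => ‖v‖ ^ 2) v := by fun_prop
    have e : newtonRem a =ᶠ[𝓝 v] fun _ => 0 := by
      filter_upwards [hc.eventually_lt_const hv] with p hp using newtonRem_eq_zero_of_lt ha hp
    exact contDiffAt_const.congr_of_eventuallyEq e
  · have hv0 : v ≠ 0 := by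
      rintro rfl
      simp at hv
      linarith
    have hn : ContDiffAt ℝ 1 (fun v : E3 => ‖v‖ ^ 2) v := (contDiff_norm_sq ℝ).contDiffAt
    have hr : ContDiffAt ℝ 1 (fun v : E3 => invRoot 0 (‖v‖ ^ 2)) v := by
      simp only [invRoot_zero_sq]
      exact (contDiffAt_norm ℝ hv0).inv (norm_ne_zero_iff.mpr hv0)
    have h1 : ContDiffAt ℝ 1 (fun v : E3 => deriv (cutoff a) (‖v‖ ^ 2)) v :=
      ((contDiff_deriv_cutoff a).of_le (by norm_cast)).contDiffAt.comp v hn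
    have h2 : ContDiffAt ℝ 1 (fun v : E3 => deriv (deriv (cutoff a)) (‖v‖ ^ 2)) v :=
      ((contDiff_deriv_deriv_cutoff a).of_le (by norm_cast)).contDiffAt.comp v hn
    exact ((((contDiffAt_const.mul hn).mul h2).add (contDiffAt_const.mul h1)).mul hr).sub
      (((contDiffAt_const.mul hn).mul h1).mul (hr.pow 3))

theorem hasCompactSupport_newtonRem (ha : 0 < a) : HasCompactSupport (newtonRem a) := by
  refine HasCompactSupport.intro (isCompact_closedBall (0 : E3) (√(2 * a))) fun v hv => ?_
  rw [mem_closedBall_zero_iff, not_le] at hv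
  rw [Real.sqrt_lt' ((Real.sqrt_nonneg _).trans_lt hv)] at hv
  have e2 : deriv (deriv (cutoff a)) (‖v‖ ^ 2) = 0 := by
    have e : deriv (cutoff a) =ᶠ[𝓝 (‖v‖ ^ 2)] fun _ => 0 := by
      filter_upwards [eventually_gt_nhds hv] with s hs using deriv_cutoff_eq_zero' ha hs
    rw [e.deriv_eq, deriv_const]
  simp [newtonRem, remainder, e2, deriv_cutoff_eq_zero' ha hv]

/-- The remainder kernel vanishes near the origin, so it is `C¹` with compact support; being even,
it makes the integral a convolution. -/
theorem differentiable_integral_newtonRem {u : E3 → ℝ} (hu : Integrable u) (ha : 0 < a) :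
    Differentiable ℝ fun x => ∫ z, u z * newtonRem a (z - x) := by
  intro x
  have h := (hasCompactSupport_newtonRem ha).hasFDerivAt_convolution_right
    (ContinuousLinearMap.mul ℝ ℝ) (μ := volume) hu.locallyIntegrable (contDiff_newtonRem ha) x
  refine h.differentiableAt.congr_of_eventuallyEq (Filter.Eventually.of_forall fun x => ?_)
  simp only [convolution, ContinuousLinearMap.mul_apply']
  refine integral_congr_ae (Filter.Eventually.of_forall fun z => ?_)
  simp only [newtonRem, norm_sub_rev z x]

end

/-! ### Pointwise differentiability of the Newtonian potential -/

/-- The weight `|v|^{-1/4}`. -/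
def rootWeight {E : Type*} [NormedAddCommGroup E] (v : E) : ℝ := ‖v‖ ^ (-(1 / 4) : ℝ)

section RootWeight

variable {E : Type*} [NormedAddCommGroup E]

theorem rootWeight_nonneg (v : E) : 0 ≤ rootWeight v := Real.rpow_nonneg (norm_nonneg _) _

theorem rootWeight_pow (v : E) (n : ℕ) : rootWeight v ^ n = ‖v‖ ^ (-(n / 4 : ℝ)) := by
  rw [rootWeight, ← Real.rpow_natCast, ← Real.rpow_mul (norm_nonneg _)]
  congr 1; ring

theorem rootWeight_pow_four (v : E) : rootWeight v ^ 4 = ‖v‖⁻¹ := by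
  rw [rootWeight_pow]; norm_num [Real.rpow_neg_one]

theorem rootWeight_pow_eight (v : E) : rootWeight v ^ 8 = (‖v‖ ^ 2)⁻¹ := by
  rw [show 8 = 4 * 2 from rfl, pow_mul, rootWeight_pow_four, inv_pow]

theorem measurable_rootWeight [MeasurableSpace E] [OpensMeasurableSpace E] :
    Measurable (rootWeight : E → ℝ) :=
  measurable_norm.pow_const _

theorem rootWeight_ge {v h : E} (hv : v ≠ 0) (hle : ‖v‖ ≤ 16 * ‖h‖) :
    rootWeight h ≤ 2 * rootWeight v := by
  have hv' := norm_pos_iff.mpr hv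
  refine le_of_pow_le_pow_left₀ (n := 4) (by norm_num) (by
    have := rootWeight_nonneg v; positivity) ?_
  rw [mul_pow, rootWeight_pow_four, rootWeight_pow_four]
  have hh : 0 < ‖h‖ := by linarith
  rw [inv_le_iff_one_le_mul₀ hh]
  rw [show (2 : ℝ) ^ 4 * ‖v‖⁻¹ * ‖h‖ = 16 * ‖h‖ / ‖v‖ by ring, le_div_iff₀ hv']
  linarith

end RootWeight

theorem locallyIntegrable_rootWeight_pow_ten :
    LocallyIntegrable (fun v : E3 => rootWeight v ^ 10) volume := by
  refine locallyIntegrable_of_norm_le_rpow (C := 1) (α := 10 / 4)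
    (by rw [finrank_euclideanSpace_fin]; norm_num) (by rw [finrank_euclideanSpace_fin]; norm_num)
    (Filter.Eventually.of_forall fun v => ?_)
    (measurable_rootWeight.pow_const _).aestronglyMeasurable
  rw [Real.norm_of_nonneg (pow_nonneg (rootWeight_nonneg _) _), rootWeight_pow, one_mul]
  norm_num

/-- With `p = |v|^{-1/4}` this bounds `|L| |v|⁻²` by `L² |v|^{-3/2} + |v|^{-5/2}`. The exponent
`3/2` must be below `2` for integrability on the plane, while its companion `4 - 3/2` must be below
`3` for integrability in space. Quarter powers make all exponents integers. -/
theorem young_far (l p : ℝ) : l * p ^ 8 ≤ l ^ 2 * p ^ 6 + p ^ 10 := by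
  nlinarith [sq_nonneg (l * p ^ 3 - p ^ 5), sq_nonneg (l * p ^ 3), sq_nonneg (p ^ 5)]

/-- Here `H`, `p`, `P` are the weights of `x' - x`, `z - x`, `z - x'`. When both distances from `z`
are comparable to or smaller than `|x' - x|`, the factor `|x' - x|⁻¹` of the difference quotient is
traded for three quarters of a power at `x` and one quarter at `x'`. -/
theorem young_near {l p P H : ℝ} (hl : 0 ≤ l) (hp : 0 ≤ p) (hH : 0 ≤ H)
    (h1 : H ≤ 2 * p) (h2 : H ≤ 2 * P) :
    H ^ 4 * (l * P ^ 4) ≤ 8 * (l ^ 2 * p ^ 6 + P ^ 10) := by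
  have h3 : H ^ 4 ≤ 16 * (p ^ 3 * P) := by
    calc H ^ 4 = H ^ 3 * H := by ring
      _ ≤ (2 * p) ^ 3 * (2 * P) := by gcongr
      _ = _ := by ring
  have h4 : H ^ 4 * (l * P ^ 4) ≤ 16 * (p ^ 3 * P) * (l * P ^ 4) := by gcongr
  nlinarith [sq_nonneg (l * p ^ 3 - P ^ 5)]

/-- A kernel with a singularity like that of the Newtonian kernel. -/
structure IsNewtonLike (K : E3 → ℝ) (C r : ℝ) : Prop where
  measurable : Measurable K
  abs_le : ∀ v, |K v| ≤ C * ‖v‖⁻¹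
  abs_sub_le : ∀ v h, 2 * ‖h‖ ≤ ‖v‖ → ‖v‖ ≤ 2 * r → |K (v - h) - K v| ≤ C * ‖h‖ * (‖v‖ ^ 2)⁻¹
  differentiableAt : ∀ v, v ≠ 0 → DifferentiableAt ℝ K v

namespace IsNewtonLike

variable {K : E3 → ℝ} {C r : ℝ} (hK : IsNewtonLike K C r)
include hK

theorem nonneg : 0 ≤ C := by
  have h := (abs_nonneg _).trans (hK.abs_le (EuclideanSpace.single 0 1))
  simpa using h

/-- The increment bound in `IsNewtonLike` is a Lipschitz bound at `v`, which controls the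
derivative. -/
theorem norm_fderiv_le {v : E3} (hv : v ≠ 0) (hvr : ‖v‖ ≤ 2 * r) :
    ‖fderiv ℝ K v‖ ≤ C * (‖v‖ ^ 2)⁻¹ := by
  have hC := hK.nonneg
  refine (hK.differentiableAt v hv).hasFDerivAt.le_of_lip' (by positivity) ?_
  have hb : Metric.ball v (‖v‖ / 2) ∈ 𝓝 v :=
    Metric.ball_mem_nhds _ (by have := norm_pos_iff.mpr hv; positivity)
  filter_upwards [hb] with z hz
  rw [Metric.mem_ball, dist_eq_norm] at hz
  have h := hK.abs_sub_le v (v - z) (by rw [norm_sub_rev]; linarith) hvr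
  rw [sub_sub_cancel, norm_sub_rev v z] at h
  rw [Real.norm_eq_abs]
  linarith [mul_right_comm C ‖z - v‖ (‖v‖ ^ 2)⁻¹]

/-- The linearization error of the kernel, with the new singularity removed. -/
theorem linearization_bound {v h : E3} (hv : v ≠ 0) (hvr : ‖v‖ ≤ 2 * r) :
    |K (v - h) - K v + fderiv ℝ K v h - (if ‖v‖ < 2 * ‖h‖ then K (v - h) else 0)|
      ≤ 3 * C * ‖h‖ * rootWeight v ^ 8 := by
  have hC := hK.nonneg
  have hv' := norm_pos_iff.mpr hv
  have hd : |fderiv ℝ K v h| ≤ C * (‖v‖ ^ 2)⁻¹ * ‖h‖ :=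
    (fderiv ℝ K v).le_of_opNorm_le (hK.norm_fderiv_le hv hvr) h
  rw [rootWeight_pow_eight]
  have hpos : 0 ≤ C * ‖h‖ * (‖v‖ ^ 2)⁻¹ := by positivity
  split_ifs with hlt
  · have h1 : |K v| ≤ 2 * (C * ‖h‖ * (‖v‖ ^ 2)⁻¹) := by
      refine (hK.abs_le v).trans ?_
      have : ‖v‖⁻¹ = ‖v‖ * (‖v‖ ^ 2)⁻¹ := by field_simp
      rw [this]
      have : C * (‖v‖ * (‖v‖ ^ 2)⁻¹) ≤ C * (2 * ‖h‖ * (‖v‖ ^ 2)⁻¹) := by gcongr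
      linarith
    rw [show K (v - h) - K v + fderiv ℝ K v h - K (v - h) = fderiv ℝ K v h - K v by ring]
    have := abs_sub (fderiv ℝ K v h) (K v)
    linarith
  · rw [sub_zero]
    have h1 := hK.abs_sub_le v h (not_lt.mp hlt) hvr
    have := abs_add_le (K (v - h) - K v) (fderiv ℝ K v h)
    linarith

end IsNewtonLike

theorem integrableOn_rootWeight_pow_ten (s : ℝ) :
    IntegrableOn (fun v : E3 => rootWeight v ^ 10) (Metric.ball 0 s) :=
  (locallyIntegrable_rootWeight_pow_ten.integrableOn_isCompact
    (isCompact_closedBall 0 s)).mono_set Metric.ball_subset_closedBall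

theorem integrable_indicator_rootWeight (s : ℝ) (x : E3) :
    Integrable (fun z : E3 => (Metric.ball (0 : E3) s).indicator (fun v => rootWeight v ^ 10)
      (z - x)) :=
  (integrableOn_rootWeight_pow_ten s).integrable_indicator measurableSet_ball |>.comp_sub_right x

theorem ae_ne_point (x : E3) : ∀ᵐ z : E3, z ≠ x := by
  simp [ae_iff, measure_singleton]

/-- The integral of `|v|^{-5/2}` over small balls is small. -/
theorem tendsto_integral_indicator_rootWeight (x : E3) :
    Filter.Tendsto (fun x' : E3 => ∫ z, (Metric.ball (0 : E3) (3 * ‖x' - x‖)).indicator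
      (fun v => rootWeight v ^ 10) (z - x')) (𝓝 x) (𝓝 0) := by
  have hshift : ∀ x' : E3, ∫ z, (Metric.ball (0 : E3) (3 * ‖x' - x‖)).indicator
      (fun v => rootWeight v ^ 10) (z - x') = ∫ v, (Metric.ball (0 : E3) (3 * ‖x' - x‖)).indicator
      (fun v => rootWeight v ^ 10) v := fun x' => integral_sub_right_eq_self _ x'
  simp only [hshift]
  have hcont : Filter.Tendsto (fun x' : E3 => 3 * ‖x' - x‖) (𝓝 x) (𝓝 0) := by
    have : ContinuousAt (fun x' : E3 => 3 * ‖x' - x‖) x := by fun_prop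
    simpa [ContinuousAt] using this
  have h := tendsto_integral_filter_of_dominated_convergence (l := 𝓝 x) (μ := (volume : Measure E3))
    (F := fun x' v => (Metric.ball (0 : E3) (3 * ‖x' - x‖)).indicator
      (fun v => rootWeight v ^ 10) v) (f := fun _ => (0 : ℝ))
    ((Metric.ball (0 : E3) 1).indicator fun v => rootWeight v ^ 10) ?_ ?_
    ((integrableOn_rootWeight_pow_ten 1).integrable_indicator measurableSet_ball) ?_
  · simpa using h
  · exact Filter.Eventually.of_forall fun x' =>
      ((measurable_rootWeight.pow_const _).indicator measurableSet_ball).aestronglyMeasurable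
  · filter_upwards [hcont.eventually_lt_const one_pos] with x' hx'
    refine Filter.Eventually.of_forall fun v => ?_
    rw [Real.norm_of_nonneg (indicator_nonneg (fun v _ => pow_nonneg (rootWeight_nonneg v) _) _)]
    exact indicator_le_indicator_of_subset (Metric.ball_subset_ball hx'.le)
      (fun v => pow_nonneg (rootWeight_nonneg v) _) _
  · filter_upwards [ae_ne_point 0] with v hv
    refine tendsto_const_nhds.congr' ?_
    filter_upwards [hcont.eventually_lt_const (norm_pos_iff.mpr hv)] with x' hx'
    rw [indicator_of_notMem]
    rw [mem_ball_zero_iff]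
    exact not_lt.mpr hx'.le

/-- A Newtonian potential is differentiable at every point at which the density has a finite
weighted energy. -/
theorem differentiableAt_potential {K : E3 → ℝ} {C r : ℝ} (hK : IsNewtonLike K C r) {L : E3 → ℝ}
    (hL : AEStronglyMeasurable L (volume.restrict (Metric.ball 0 r))) {x : E3}
    (hx : x ∈ Metric.ball (0 : E3) r)
    (hI : IntegrableOn (fun z => L z ^ 2 * rootWeight (z - x) ^ 6) (Metric.ball 0 r))
    (hint : ∀ x', IntegrableOn (fun z => L z * K (z - x')) (Metric.ball 0 r)) :
    DifferentiableAt ℝ (fun x' => ∫ z in Metric.ball 0 r, L z * K (z - x')) x := by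
  have hC := hK.nonneg
  set μ := (volume : Measure E3).restrict (Metric.ball 0 r) with hμ
  replace hI : Integrable (fun z => L z ^ 2 * rootWeight (z - x) ^ 6) μ := hI
  replace hint : ∀ x', Integrable (fun z => L z * K (z - x')) μ := hint
  have hball : ∀ᵐ z ∂μ, z ≠ x ∧ ‖z - x‖ ≤ 2 * r := by
    filter_upwards [ae_restrict_mem measurableSet_ball, ae_restrict_of_ae (ae_ne_point x)] with z hz hz'
    refine ⟨hz', (norm_sub_le _ _).trans ?_⟩
    rw [mem_ball_zero_iff] at hz hx
    linarith
  have hten : Integrable (fun z => rootWeight (z - x) ^ 10) μ := by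
    refine ((integrable_indicator_rootWeight (2 * r) x).restrict (s := Metric.ball 0 r)).congr ?_
    filter_upwards [ae_restrict_mem measurableSet_ball] with z hz
    rw [indicator_of_mem]
    rw [mem_ball_zero_iff] at *
    exact (norm_sub_le _ _).trans_lt (by linarith)
  have hwm : AEStronglyMeasurable (fun z : E3 => rootWeight (z - x)) μ :=
    (measurable_rootWeight.comp (measurable_id.sub_const x)).aestronglyMeasurable
  -- This function dominates the formal derivative of the integrand and, up to a constant, the
  -- difference quotients away from their moving singularity.
  have hG : Integrable (fun z => ‖L z‖ * rootWeight (z - x) ^ 8) μ := by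
    refine (hI.add hten).mono' (hL.norm.mul (hwm.pow 8)) (Filter.Eventually.of_forall fun z => ?_)
    rw [Real.norm_of_nonneg (mul_nonneg (norm_nonneg _) (pow_nonneg (rootWeight_nonneg _) _))]
    have := young_far ‖L z‖ (rootWeight (z - x))
    rwa [Real.norm_eq_abs, sq_abs] at this
  have hDm : AEStronglyMeasurable (fun z => fderiv ℝ K (z - x)) μ :=
    ((measurable_fderiv ℝ K).comp (measurable_id.sub_const x)).aestronglyMeasurable
  have hD : Integrable (fun z => L z • fderiv ℝ K (z - x)) μ := by
    refine (hG.const_mul C).mono' (hL.smul hDm) ?_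
    filter_upwards [hball] with z hz
    have h := hK.norm_fderiv_le (sub_ne_zero.mpr hz.1) hz.2
    rw [norm_smul, rootWeight_pow_eight]
    calc ‖L z‖ * ‖fderiv ℝ K (z - x)‖ ≤ ‖L z‖ * (C * (‖z - x‖ ^ 2)⁻¹) := by gcongr
      _ = _ := by ring
  have hmain : HasFDerivAt (fun x' => ∫ z, L z * K (z - x') ∂μ)
      (-∫ z, L z • fderiv ℝ K (z - x) ∂μ) x := by
    rw [hasFDerivAt_iff_tendsto]
    -- The singularity at the moving point `x'` has no bound independent of `x'`, so this piece is
    -- split off and shown to be negligible separately.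
    set near : E3 → E3 → ℝ := fun x' z => if ‖z - x‖ < 2 * ‖x' - x‖ then K (z - x') else 0 with hnear
    set F : E3 → E3 → ℝ := fun x' z => L z * (K (z - x') - K (z - x)
      + fderiv ℝ K (z - x) (x' - x) - near x' z) with hF
    have hKm : ∀ x', AEStronglyMeasurable (fun z => K (z - x')) μ := fun x' =>
      (hK.measurable.comp (measurable_id.sub_const x')).aestronglyMeasurable
    have hnearm : ∀ x', AEStronglyMeasurable (near x') μ := fun x' =>
      (Measurable.ite (measurableSet_lt (by fun_prop) measurable_const)
        (hK.measurable.comp (measurable_id.sub_const x')) measurable_const).aestronglyMeasurable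
    have hFm : ∀ x', AEStronglyMeasurable (F x') μ := fun x' =>
      hL.mul ((((hKm x').sub (hKm x)).add
        ((measurable_fderiv_apply_const ℝ K (x' - x)).comp
          (measurable_id.sub_const x)).aestronglyMeasurable).sub (hnearm x'))
    have hFb : ∀ x', ∀ᵐ z ∂μ, ‖‖x' - x‖⁻¹ * ‖F x' z‖‖
        ≤ 3 * C * (‖L z‖ * rootWeight (z - x) ^ 8) := by
      intro x'
      filter_upwards [hball] with z hz
      have h := hK.linearization_bound (h := x' - x) (sub_ne_zero.mpr hz.1) hz.2
      rw [sub_sub_sub_cancel_right] at h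
      have hp := rootWeight_nonneg (z - x)
      rw [norm_mul, norm_norm, norm_inv, norm_norm, hF, norm_mul]
      rcases eq_or_ne x' x with rfl | hne
      · simp only [sub_self, norm_zero, inv_zero, zero_mul]; positivity
      · have hn : 0 < ‖x' - x‖ := norm_pos_iff.mpr (sub_ne_zero.mpr hne)
        calc ‖x' - x‖⁻¹ * (‖L z‖ * ‖K (z - x') - K (z - x) + fderiv ℝ K (z - x) (x' - x)
              - near x' z‖)
            ≤ ‖x' - x‖⁻¹ * (‖L z‖ * (3 * C * ‖x' - x‖ * rootWeight (z - x) ^ 8)) := by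
              gcongr; exact h
          _ = _ := by field_simp
    have hni : ∀ x', Integrable (fun z => L z * near x' z) μ := by
      intro x'
      refine (hint x').mono (hL.mul (hnearm x')) (Filter.Eventually.of_forall fun z => ?_)
      rw [norm_mul, norm_mul]
      refine mul_le_mul_of_nonneg_left ?_ (norm_nonneg _)
      simp only [hnear]
      split_ifs
      · exact le_rfl
      · rw [norm_zero]; exact norm_nonneg _
    have hDi : ∀ v, Integrable (fun z => L z * fderiv ℝ K (z - x) v) μ := fun v =>
      hD.apply_continuousLinearMap v
    have hbi : ∀ x', Integrable (fun z => L z * (K (z - x') - K (z - x)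
        + fderiv ℝ K (z - x) (x' - x))) μ := by
      intro x'
      refine (((hint x').sub (hint x)).add (hDi (x' - x))).congr
        (Filter.Eventually.of_forall fun z => ?_)
      simp only [Pi.add_apply, Pi.sub_apply]
      ring
    have hFi : ∀ x', Integrable (F x') μ := by
      intro x'
      refine ((hbi x').sub (hni x')).congr (Filter.Eventually.of_forall fun z => ?_)
      simp only [Pi.sub_apply, hF]
      ring
    have heq : ∀ x', (∫ z, L z * K (z - x') ∂μ) - (∫ z, L z * K (z - x) ∂μ)
        - (-∫ z, L z • fderiv ℝ K (z - x) ∂μ) (x' - x)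
        = (∫ z, F x' z ∂μ) + ∫ z, L z * near x' z ∂μ := by
      intro x'
      rw [neg_apply, ContinuousLinearMap.integral_apply hD, sub_neg_eq_add,
        ← integral_sub (hint x') (hint x), ← integral_add (hFi x') (hni x')]
      simp only [smul_apply, smul_eq_mul]
      have hsub := (hint x').sub (hint x)
      simp only [Pi.sub_def] at hsub
      rw [← integral_add hsub (hDi (x' - x))]
      refine integral_congr_ae (Filter.Eventually.of_forall fun z => ?_)
      simp only [hF]
      ring
    -- For fixed `z ≠ x` the near piece is eventually zero, so the integrand tends to zero by
    -- differentiability of the kernel; domination does the rest.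
    have T1 : Filter.Tendsto (fun x' => ∫ z, ‖x' - x‖⁻¹ * ‖F x' z‖ ∂μ) (𝓝 x) (𝓝 0) := by
      have h := tendsto_integral_filter_of_dominated_convergence (l := 𝓝 x) (μ := μ)
        (F := fun x' z => ‖x' - x‖⁻¹ * ‖F x' z‖) (f := fun _ => (0 : ℝ)) _
        (Filter.Eventually.of_forall fun x' => (hFm x').norm.const_mul _)
        (Filter.Eventually.of_forall hFb) (hG.const_mul (3 * C)) ?_
      · simpa using h
      · filter_upwards [hball] with z hz
        have hq := sub_ne_zero.mpr hz.1
        have hd : HasFDerivAt (fun x' => K (z - x')) (-fderiv ℝ K (z - x)) x := by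
          have h1 := (hK.differentiableAt _ hq).hasFDerivAt.comp x
            ((hasFDerivAt_id (𝕜 := ℝ) x).const_sub z)
          refine h1.congr_fderiv ?_
          ext v
          simp
        have h2 := (hasFDerivAt_iff_tendsto.mp hd).const_mul ‖L z‖
        rw [mul_zero] at h2
        refine h2.congr' ?_
        have hcont : Filter.Tendsto (fun x' : E3 => 2 * ‖x' - x‖) (𝓝 x) (𝓝 0) := by
          have : ContinuousAt (fun x' : E3 => 2 * ‖x' - x‖) x := by fun_prop
          simpa [ContinuousAt] using this
        filter_upwards [hcont.eventually_lt_const (norm_pos_iff.mpr hq)] with x' hx'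
        simp only [hF, hnear, if_neg (not_lt.mpr hx'.le), sub_zero, norm_mul,
          neg_apply, sub_neg_eq_add]
        ring
    have T2 : Filter.Tendsto (fun x' => ∫ z, (if ‖z - x‖ < 2 * ‖x' - x‖ then
        L z ^ 2 * rootWeight (z - x) ^ 6 else 0) ∂μ) (𝓝 x) (𝓝 0) := by
      have h := tendsto_integral_filter_of_dominated_convergence (l := 𝓝 x) (μ := μ)
        (F := fun x' z => if ‖z - x‖ < 2 * ‖x' - x‖ then L z ^ 2 * rootWeight (z - x) ^ 6 else 0)
        (f := fun _ => (0 : ℝ)) (fun z => L z ^ 2 * rootWeight (z - x) ^ 6) ?_ ?_ hI ?_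
      · simpa using h
      · refine Filter.Eventually.of_forall fun x' => ?_
        exact (hI.1.indicator (measurableSet_lt (f := fun z : E3 => ‖z - x‖)
          (g := fun _ => 2 * ‖x' - x‖) (by fun_prop) measurable_const)).congr
          (Filter.Eventually.of_forall fun z => by simp [indicator_apply])
      · refine Filter.Eventually.of_forall fun x' => Filter.Eventually.of_forall fun z => ?_
        have hp := rootWeight_nonneg (z - x)
        have h0 : 0 ≤ L z ^ 2 * rootWeight (z - x) ^ 6 := by positivity
        split_ifs
        · exact (Real.norm_of_nonneg h0).le
        · rwa [norm_zero]
      · filter_upwards [hball] with z hz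
        have hcont : Filter.Tendsto (fun x' : E3 => 2 * ‖x' - x‖) (𝓝 x) (𝓝 0) := by
          have : ContinuousAt (fun x' : E3 => 2 * ‖x' - x‖) x := by fun_prop
          simpa [ContinuousAt] using this
        refine tendsto_const_nhds.congr' ?_
        filter_upwards [hcont.eventually_lt_const
          (norm_pos_iff.mpr (sub_ne_zero.mpr hz.1))] with x' hx'
        rw [if_neg (not_lt.mpr hx'.le)]
    -- The near piece is bounded by the energy in a shrinking ball around `x` plus the integral of
    -- `|v|^{-5/2}` over a shrinking ball. The radius `3‖x' - x‖` comes from `‖z - x‖ < 2‖x' - x‖`.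
    have hnb : ∀ x', ‖x' - x‖⁻¹ * ‖∫ z, L z * near x' z ∂μ‖ ≤
        8 * C * ((∫ z, (if ‖z - x‖ < 2 * ‖x' - x‖ then
          L z ^ 2 * rootWeight (z - x) ^ 6 else 0) ∂μ) +
          ∫ z, (Metric.ball (0 : E3) (3 * ‖x' - x‖)).indicator
            (fun v => rootWeight v ^ 10) (z - x')) := by
      intro x'
      have i1 : Integrable (fun z => if ‖z - x‖ < 2 * ‖x' - x‖ then
          L z ^ 2 * rootWeight (z - x) ^ 6 else 0) μ :=
        (hI.indicator (measurableSet_lt (f := fun z : E3 => ‖z - x‖)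
          (g := fun _ => 2 * ‖x' - x‖) (by fun_prop) measurable_const)).congr
          (Filter.Eventually.of_forall fun z => by simp [indicator_apply])
      have i2 := integrable_indicator_rootWeight (3 * ‖x' - x‖) x'
      have hle : ∫ z, (Metric.ball (0 : E3) (3 * ‖x' - x‖)).indicator
            (fun v => rootWeight v ^ 10) (z - x') ∂μ ≤
          ∫ z, (Metric.ball (0 : E3) (3 * ‖x' - x‖)).indicator
            (fun v => rootWeight v ^ 10) (z - x') :=
        setIntegral_le_integral i2 (Filter.Eventually.of_forall fun z =>
          indicator_nonneg (fun v _ => pow_nonneg (rootWeight_nonneg v) _) _)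
      calc ‖x' - x‖⁻¹ * ‖∫ z, L z * near x' z ∂μ‖
          ≤ ‖x' - x‖⁻¹ * ∫ z, ‖L z * near x' z‖ ∂μ := by
            gcongr; exact norm_integral_le_integral_norm _
        _ = ∫ z, ‖x' - x‖⁻¹ * ‖L z * near x' z‖ ∂μ := (integral_const_mul _ _).symm
        _ ≤ ∫ z, 8 * C * ((if ‖z - x‖ < 2 * ‖x' - x‖ then
              L z ^ 2 * rootWeight (z - x) ^ 6 else 0) +
              (Metric.ball (0 : E3) (3 * ‖x' - x‖)).indicator
                (fun v => rootWeight v ^ 10) (z - x')) ∂μ := by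
            refine integral_mono_of_nonneg (Filter.Eventually.of_forall fun z => by positivity)
              ((i1.add i2.restrict).const_mul _) ?_
            filter_upwards [hball] with z hz
            have hind : 0 ≤ (Metric.ball (0 : E3) (3 * ‖x' - x‖)).indicator
                (fun v => rootWeight v ^ 10) (z - x') :=
              indicator_nonneg (fun v _ => pow_nonneg (rootWeight_nonneg v) _) _
            have hp := rootWeight_nonneg (z - x)
            simp only [hnear]
            split_ifs with hlt
            · rcases eq_or_ne z x' with rfl | hne
              -- Since `0⁻¹ = 0`, the size bound forces the kernel to vanish at the origin.
              · have h0 : K (z - z) = 0 := by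
                  have := hK.abs_le (z - z)
                  rw [sub_self, norm_zero, inv_zero, mul_zero] at this
                  rw [sub_self]
                  exact abs_nonpos_iff.mp this
                rw [h0, mul_zero, norm_zero, mul_zero]
                positivity
              · have hsub : ‖z - x'‖ < 3 * ‖x' - x‖ := by
                  have : z - x' = (z - x) - (x' - x) := by abel
                  rw [this]
                  exact (norm_sub_le _ _).trans_lt (by linarith)
                rw [indicator_of_mem (mem_ball_zero_iff.mpr hsub)]
                have hn := norm_nonneg (x' - x)
                have hy := young_near (norm_nonneg (L z)) hp (rootWeight_nonneg (x' - x))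
                  (rootWeight_ge (sub_ne_zero.mpr hz.1) (by linarith))
                  (rootWeight_ge (sub_ne_zero.mpr hne) (by linarith))
                rw [rootWeight_pow_four, rootWeight_pow_four, Real.norm_eq_abs, sq_abs] at hy
                calc ‖x' - x‖⁻¹ * ‖L z * K (z - x')‖
                    ≤ ‖x' - x‖⁻¹ * (|L z| * (C * ‖z - x'‖⁻¹)) := by
                      rw [norm_mul]; gcongr; exacts [le_rfl, hK.abs_le _]
                  _ = C * (‖x' - x‖⁻¹ * (|L z| * ‖z - x'‖⁻¹)) := by ring
                  _ ≤ C * _ := mul_le_mul_of_nonneg_left hy hC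
                  _ = _ := by ring
            · rw [mul_zero, norm_zero, mul_zero]
              positivity
        _ = 8 * C * ((∫ z, (if ‖z - x‖ < 2 * ‖x' - x‖ then
              L z ^ 2 * rootWeight (z - x) ^ 6 else 0) ∂μ) +
              ∫ z, (Metric.ball (0 : E3) (3 * ‖x' - x‖)).indicator
                (fun v => rootWeight v ^ 10) (z - x') ∂μ) := by
            rw [integral_const_mul, integral_add i1 i2.restrict]
        _ ≤ _ := by gcongr
    have T3 := T1.add ((T2.add (tendsto_integral_indicator_rootWeight x)).const_mul (8 * C))
    rw [add_zero, mul_zero, add_zero] at T3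
    refine squeeze_zero (fun x' => by positivity) (fun x' => ?_) T3
    rw [heq]
    calc ‖x' - x‖⁻¹ * ‖(∫ z, F x' z ∂μ) + ∫ z, L z * near x' z ∂μ‖
        ≤ ‖x' - x‖⁻¹ * ‖∫ z, F x' z ∂μ‖ + ‖x' - x‖⁻¹ * ‖∫ z, L z * near x' z ∂μ‖ := by
          rw [← mul_add]; gcongr; exact norm_add_le _ _
      _ ≤ _ := by
          refine add_le_add ?_ (hnb x')
          rw [integral_const_mul]
          gcongr
          exact norm_integral_le_integral_norm _
  exact hmain.differentiableAt

/-! ### The truncated kernel has a singularity of Newtonian type. -/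

theorem exists_lipschitz_cutoff {a : ℝ} (ha : 0 < a) :
    ∃ M, 0 ≤ M ∧ ∀ s t : ℝ, |cutoff a s - cutoff a t| ≤ M * |s - t| := by
  obtain ⟨M, hM⟩ := (contDiff_deriv_cutoff a).continuous.bounded_above_of_compact_support
    (hasCompactSupport_deriv_cutoff ha)
  refine ⟨M, (norm_nonneg _).trans (hM 0), fun s t => ?_⟩
  exact convex_univ.norm_image_sub_le_of_norm_deriv_le
    (fun x _ => (hasDerivAt_cutoff a x).differentiableAt) (fun x _ => hM x) (mem_univ t)
    (mem_univ s)

theorem exists_isNewtonLike_newton {a : ℝ} (ha : 0 < a) {r : ℝ} (hr : 0 < r) :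
    ∃ C, IsNewtonLike (newton a) C r := by
  obtain ⟨M, hM0, hM⟩ := exists_lipschitz_cutoff ha
  -- The `2` comes from the increment of `|v|⁻¹`. The rest comes from the increment of the cutoff:
  -- `‖v - h‖ + ‖v‖ ≤ 5r` bounds the difference of squares, and `‖v‖ ≤ 2r` supplies one more power
  -- of the norm.
  refine ⟨2 + 10 * M * r ^ 2, measurable_newton a, fun v => ?_, fun v h hvh hvr => ?_,
    fun v hv => ?_⟩
  · refine (abs_newton_le a v).trans (le_mul_of_one_le_left (by positivity) ?_)
    have : 0 ≤ 10 * M * r ^ 2 := by positivity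
    linarith
  · rcases eq_or_ne v 0 with rfl | hv
    · have hh : h = 0 := by
        rw [norm_zero] at hvh
        exact norm_le_zero_iff.mp (by linarith)
      simp [hh]
    · have hv' := norm_pos_iff.mpr hv
      have hn := norm_nonneg h
      have hp1 : ‖v‖ - ‖h‖ ≤ ‖v - h‖ := norm_sub_norm_le v h
      have hp2 : ‖v - h‖ ≤ ‖v‖ + ‖h‖ := norm_sub_le v h
      have hp : ‖v‖ / 2 ≤ ‖v - h‖ := by linarith
      have hp0 : 0 < ‖v - h‖ := by linarith
      have hpq : |‖v‖ - ‖v - h‖| ≤ ‖h‖ := by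
        have := abs_norm_sub_norm_le v (v - h)
        rwa [sub_sub_cancel] at this
      have e : newton a (v - h) - newton a v
          = cutoff a (‖v - h‖ ^ 2) * ((‖v‖ - ‖v - h‖) * (‖v - h‖⁻¹ * ‖v‖⁻¹))
            + (cutoff a (‖v - h‖ ^ 2) - cutoff a (‖v‖ ^ 2)) * ‖v‖⁻¹ := by
        rw [newton, newton]
        field_simp
        ring
      have b1 : |cutoff a (‖v - h‖ ^ 2) * ((‖v‖ - ‖v - h‖) * (‖v - h‖⁻¹ * ‖v‖⁻¹))|
          ≤ 2 * (‖h‖ * (‖v‖ ^ 2)⁻¹) := by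
        have hinv : ‖v - h‖⁻¹ ≤ 2 * ‖v‖⁻¹ := by
          have := inv_anti₀ (by positivity) hp
          rwa [inv_div, div_eq_mul_inv] at this
        rw [abs_mul, abs_of_nonneg (cutoff_nonneg _ _), abs_mul,
          abs_of_nonneg (show 0 ≤ ‖v - h‖⁻¹ * ‖v‖⁻¹ by positivity)]
        calc cutoff a (‖v - h‖ ^ 2) * (|‖v‖ - ‖v - h‖| * (‖v - h‖⁻¹ * ‖v‖⁻¹))
            ≤ 1 * (‖h‖ * (2 * ‖v‖⁻¹ * ‖v‖⁻¹)) := by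
              gcongr
              exact cutoff_le_one _ _
          _ = _ := by field_simp
      have b2 : |(cutoff a (‖v - h‖ ^ 2) - cutoff a (‖v‖ ^ 2)) * ‖v‖⁻¹|
          ≤ 10 * M * r ^ 2 * (‖h‖ * (‖v‖ ^ 2)⁻¹) := by
        rw [abs_mul, abs_of_nonneg (show 0 ≤ ‖v‖⁻¹ by positivity)]
        have h1 : |‖v - h‖ ^ 2 - ‖v‖ ^ 2| ≤ ‖h‖ * (5 * r) := by
          rw [sq_sub_sq, abs_mul, mul_comm, abs_sub_comm]
          rw [abs_of_nonneg (show 0 ≤ ‖v - h‖ + ‖v‖ by positivity)]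
          gcongr
          linarith
        calc |cutoff a (‖v - h‖ ^ 2) - cutoff a (‖v‖ ^ 2)| * ‖v‖⁻¹
            ≤ (M * (‖h‖ * (5 * r))) * ‖v‖⁻¹ := by
              gcongr
              exact (hM _ _).trans (by gcongr)
          _ = (M * (‖h‖ * (5 * r))) * (‖v‖ * (‖v‖ ^ 2)⁻¹) := by field_simp
          _ ≤ (M * (‖h‖ * (5 * r))) * (2 * r * (‖v‖ ^ 2)⁻¹) := by gcongr
          _ = _ := by ring
      rw [e]
      refine (abs_add_le _ _).trans ((add_le_add b1 b2).trans (le_of_eq ?_))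
      ring
  · have h1 : DifferentiableAt ℝ (fun v : E3 => ‖v‖) v :=
      (contDiffAt_norm (n := 1) ℝ hv).differentiableAt one_ne_zero
    exact (((contDiff_cutoff a).differentiable (by simp) _).comp v (h1.pow 2)).mul
      (h1.inv (norm_ne_zero_iff.mpr hv))

/-! ### Weighted energies on the equatorial plane -/

/-- The projection `(z₁, z₂, z₃) ↦ (z₁, z₂)`. -/
def shadow (z : E3) : E2 := !₂[z 0, z 1]

theorem norm_shadow_sub_le (z : E3) (y : E2) : ‖shadow z - y‖ ≤ ‖z - flat y‖ := by
  rw [EuclideanSpace.norm_eq, EuclideanSpace.norm_eq, Fin.sum_univ_three, Fin.sum_univ_two]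
  refine Real.sqrt_le_sqrt ?_
  simp [shadow, flat_apply]
  positivity

theorem norm_shadow_le (z : E3) : ‖shadow z‖ ≤ ‖z‖ := by
  simpa using norm_shadow_sub_le z 0

/-- Projection shortens distances. The point `y = shadow z` is excluded because the right-hand
weight takes the value `0` there. -/
theorem rootWeight_sub_flat_le {z : E3} {y : E2} (h : y ≠ shadow z) :
    rootWeight (z - flat y) ≤ rootWeight (shadow z - y) :=
  Real.rpow_le_rpow_of_nonpos (norm_pos_iff.mpr (sub_ne_zero.mpr h.symm))
    (norm_shadow_sub_le z y) (by norm_num)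

theorem integrableOn_rootWeight_pow_six (s : ℝ) :
    IntegrableOn (fun v : E2 => rootWeight v ^ 6) (Metric.ball 0 s) := by
  refine integrableOn_ball_of_norm_le_rpow (C := 1) (α := 6 / 4)
    (by rw [finrank_euclideanSpace_fin]; norm_num) (by rw [finrank_euclideanSpace_fin]; norm_num)
    (Filter.Eventually.of_forall fun v => ?_)
    (measurable_rootWeight.pow_const _).aestronglyMeasurable
  rw [Real.norm_of_nonneg (pow_nonneg (rootWeight_nonneg _) _), rootWeight_pow, one_mul]
  norm_num

/-- The bound does not depend on `z`, which is what Tonelli needs: after projection only a translate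
of an integrable planar singularity remains. -/
theorem lintegral_rootWeight_le {r : ℝ} {z : E3} (hz : z ∈ Metric.ball (0 : E3) r) :
    ∫⁻ y in Metric.ball (0 : E2) r, ENNReal.ofReal (rootWeight (z - flat y) ^ 6) ≤
      ∫⁻ v in Metric.ball (0 : E2) (2 * r), ENNReal.ofReal (rootWeight v ^ 6) := by
  rw [← lintegral_indicator measurableSet_ball, ← lintegral_indicator measurableSet_ball,
    ← lintegral_sub_left_eq_self ((Metric.ball (0 : E2) (2 * r)).indicator
      fun v => ENNReal.ofReal (rootWeight v ^ 6)) (shadow z)]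
  have hne : ∀ᵐ y : E2, y ≠ shadow z := by
    simp [ae_iff, measure_singleton]
  refine lintegral_mono_ae ?_
  filter_upwards [hne] with y hy
  by_cases hyr : y ∈ Metric.ball (0 : E2) r
  · have hmem : shadow z - y ∈ Metric.ball (0 : E2) (2 * r) := by
      rw [mem_ball_zero_iff] at *
      have := norm_shadow_le z
      exact (norm_sub_le _ _).trans_lt (by linarith)
    rw [indicator_of_mem hyr, indicator_of_mem hmem]
    exact ENNReal.ofReal_le_ofReal (pow_le_pow_left₀ (rootWeight_nonneg _)
      (rootWeight_sub_flat_le hy) 6)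
  · rw [indicator_of_notMem hyr]
    exact zero_le

/-- Tonelli: integrating the energy over the plane first costs a constant factor, so its total is at
most a multiple of the squared `L²` norm of `L`. -/
theorem ae_integrableOn_sq_mul_rootWeight {L : E3 → ℝ} {r : ℝ}
    (hL : MemLp L 2 (volume.restrict (Metric.ball 0 r))) :
    ∀ᵐ y ∂(volume.restrict (Metric.ball (0 : E2) r)),
      IntegrableOn (fun z => L z ^ 2 * rootWeight (z - flat y) ^ 6) (Metric.ball 0 r) := by
  set μ := (volume : Measure E3).restrict (Metric.ball 0 r)
  set ν := (volume : Measure E2).restrict (Metric.ball 0 r)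
  have hw : Measurable fun p : E2 × E3 => ENNReal.ofReal (rootWeight (p.2 - flat p.1) ^ 6) :=
    ((measurable_rootWeight.comp (measurable_snd.sub
      (flat.continuous.measurable.comp measurable_fst))).pow_const 6).ennreal_ofReal
  have hLm : AEMeasurable (fun z => ENNReal.ofReal (L z ^ 2)) μ :=
    (hL.1.aemeasurable.pow_const 2).ennreal_ofReal
  have hm : AEMeasurable (fun p : E2 × E3 => ENNReal.ofReal (L p.2 ^ 2) *
      ENNReal.ofReal (rootWeight (p.2 - flat p.1) ^ 6)) (ν.prod μ) :=
    hLm.comp_snd.mul hw.aemeasurable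
  have hB : ∫⁻ v in Metric.ball (0 : E2) (2 * r), ENNReal.ofReal (rootWeight v ^ 6) < ⊤ :=
    (integrableOn_rootWeight_pow_six (2 * r)).lintegral_lt_top
  have hfin : ∫⁻ y, ∫⁻ z, ENNReal.ofReal (L z ^ 2) *
      ENNReal.ofReal (rootWeight (z - flat y) ^ 6) ∂μ ∂ν ≠ ⊤ := by
    rw [lintegral_lintegral_swap hm]
    refine ne_of_lt (lt_of_le_of_lt (b := ∫⁻ z, ENNReal.ofReal (L z ^ 2) *
      (∫⁻ v in Metric.ball (0 : E2) (2 * r), ENNReal.ofReal (rootWeight v ^ 6)) ∂μ) ?_ ?_)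
    · refine lintegral_mono_ae ?_
      filter_upwards [ae_restrict_mem measurableSet_ball] with z hz
      rw [lintegral_const_mul' _ _ ENNReal.ofReal_ne_top]
      exact mul_le_mul_right (lintegral_rootWeight_le hz) _
    · rw [lintegral_mul_const' _ _ hB.ne]
      exact ENNReal.mul_lt_top hL.integrable_sq.lintegral_lt_top hB
  have hae := ae_lt_top' hm.lintegral_prod_right' hfin
  filter_upwards [hae] with y hy
  have hym : AEStronglyMeasurable (fun z => L z ^ 2 * rootWeight (z - flat y) ^ 6) μ :=
    (hL.1.pow 2).mul ((measurable_rootWeight.comp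
      (measurable_id.sub_const (flat y))).pow_const 6).aestronglyMeasurable
  refine ⟨hym, ?_⟩
  rw [hasFiniteIntegral_iff_ofReal (Filter.Eventually.of_forall fun z =>
    mul_nonneg (sq_nonneg _) (pow_nonneg (rootWeight_nonneg _) _))]
  simpa only [ENNReal.ofReal_mul (sq_nonneg _)] using hy

/-- A continuous function with square integrable weak Laplacian is differentiable at almost every
point of the equatorial plane. -/
theorem ae_differentiableAt_flat {u L : E3 → ℝ} {r : ℝ}
    (hu : ContinuousOn u (Metric.closedBall 0 r))
    (hL : MemLp L 2 (volume.restrict (Metric.ball 0 r)))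
    (hw : ∀ φ : E3 → ℝ, ContDiff ℝ ∞ φ → HasCompactSupport φ → tsupport φ ⊆ Metric.ball 0 r →
      ∫ z in Metric.ball 0 r, u z * lap φ z = ∫ z in Metric.ball 0 r, L z * φ z) :
    ∀ᵐ y ∂(volume.restrict (Metric.ball (0 : E2) r)), DifferentiableAt ℝ u (flat y) := by
  set B := Metric.ball (0 : E3) r with hB
  have hBm : MeasurableSet B := measurableSet_ball
  have hU : Integrable (B.indicator u) :=
    ((hu.integrableOn_compact (isCompact_closedBall 0 r)).mono_set
      Metric.ball_subset_closedBall).integrable_indicator hBm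
  have hL' : MemLp (B.indicator L) 2 volume := (memLp_indicator_iff_restrict hBm).mpr hL
  have hw' : HasWeakLap B (B.indicator u) (B.indicator L) := by
    intro φ h1 h2 h3
    have e : ∀ f g : E3 → ℝ, ∫ z, B.indicator f z * g z = ∫ z in B, f z * g z := by
      intro f g
      rw [← integral_indicator hBm]
      exact integral_congr_ae (Filter.Eventually.of_forall fun z => by
        by_cases hz : z ∈ B <;> simp [hz])
    rw [e, e]
    exact hw φ h1 h2 h3
  filter_upwards [ae_integrableOn_sq_mul_rootWeight hL, ae_restrict_mem measurableSet_ball]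
    with y hy hyr
  set x := flat y
  have hx : x ∈ B := flat_mem_ball.mpr hyr
  have hxr : ‖x‖ < r := mem_ball_zero_iff.mp hx
  have hr : 0 < r := (norm_nonneg x).trans_lt hxr
  -- Half the distance to the sphere: with `√(2a) = d`, a single truncation works for every `x'`
  -- within `d` of `x`, so the representation holds on a neighbourhood and can be differentiated.
  set d := (r - ‖x‖) / 2 with hd
  have hd0 : 0 < d := by rw [hd]; linarith
  set a := d ^ 2 / 2 with ha
  have ha0 : 0 < a := by positivity
  have hsq : √(2 * a) = d := by rw [ha, mul_div_cancel₀ _ two_ne_zero, Real.sqrt_sq hd0.le]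
  obtain ⟨C, hK⟩ := exists_isNewtonLike_newton ha0 hr
  have eP : ∀ x', ∫ z, B.indicator L z * newton a (z - x')
      = ∫ z in B, L z * newton a (z - x') := by
    intro x'
    rw [← integral_indicator hBm]
    exact integral_congr_ae (Filter.Eventually.of_forall fun z => by
      by_cases hz : z ∈ B <;> simp [hz])
  have hint : ∀ x', IntegrableOn (fun z => L z * newton a (z - x')) B := by
    intro x'
    refine (integrable_mul_newton hL' ha0 x').integrableOn.congr_fun (fun z hz => ?_) hBm
    simp [hz]
  have hP := differentiableAt_potential hK hL.1 hx hy hint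
  have hS := differentiable_integral_newtonRem hU ha0 x
  have hrep : u =ᶠ[𝓝 x] fun x' => newtonConst⁻¹ * ((∫ z, B.indicator u z * newtonRem a (z - x'))
      - ∫ z in B, L z * newton a (z - x')) := by
    filter_upwards [Metric.isOpen_ball.mem_nhds hx, Metric.ball_mem_nhds x hd0] with x' hx' hxd
    have hsub : Metric.closedBall x' (√(2 * a)) ⊆ B := by
      intro z hz
      rw [hsq, Metric.mem_closedBall, dist_eq_norm] at hz
      rw [Metric.mem_ball, dist_eq_norm] at hxd
      rw [hB, mem_ball_zero_iff]
      have e : z = (z - x') + (x' - x) + x := by abel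
      rw [e]
      refine (norm_add₃_le).trans_lt ?_
      linarith
    have hev : B.indicator u =ᶠ[𝓝 x'] u := by
      filter_upwards [Metric.isOpen_ball.mem_nhds hx'] with z hz using indicator_of_mem hz u
    have hcu : ContinuousAt (B.indicator u) x' :=
      (hu.continuousAt (Filter.mem_of_superset (Metric.isOpen_ball.mem_nhds hx')
        Metric.ball_subset_closedBall)).congr hev.symm
    have h := newton_representation hU hL' hw' ha0 hsub hcu
    rw [eP, hev.self_of_nhds] at h
    rw [← h, inv_mul_cancel_left₀ newtonConst_pos.ne']
  exact ((hS.sub hP).const_mul _).congr_of_eventuallyEq hrep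

section

/-! ### Charts of Sobolev class -/

/-- `φ` is a test function on `O`. -/
def IsTest (O : Set E3) (φ : E3 → ℝ) : Prop :=
  ContDiff ℝ ∞ φ ∧ HasCompactSupport φ ∧ tsupport φ ⊆ O

/-- The partial derivative of a function on `ℝ³`. -/
def partialDeriv (i : Fin 3) (φ : E3 → ℝ) (z : E3) : ℝ :=
  fderiv ℝ φ z (EuclideanSpace.single i 1)

variable {O : Set E3} {φ : E3 → ℝ}

theorem IsTest.mono {O' : Set E3} (h : IsTest O φ) (hO : O ⊆ O') : IsTest O' φ :=
  ⟨h.1, h.2.1, h.2.2.trans hO⟩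

theorem IsTest.partialDeriv (h : IsTest O φ) (i : Fin 3) : IsTest O (partialDeriv i φ) :=
  ⟨(h.1.fderiv_right (m := ∞) (by simp)).clm_apply contDiff_const,
    h.2.1.fderiv_apply ℝ _, (tsupport_fderiv_apply_subset ℝ _).trans h.2.2⟩

theorem IsTest.eq_zero (h : IsTest O φ) {z : E3} (hz : z ∉ O) : φ z = 0 :=
  image_eq_zero_of_notMem_tsupport fun hz' => hz (h.2.2 hz')

theorem IsTest.setIntegral (h : IsTest O φ) (f : E3 → ℝ) :
    ∫ z in O, f z * φ z = ∫ z, f z * φ z :=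
  setIntegral_eq_integral_of_forall_compl_eq_zero fun z hz => by rw [h.eq_zero hz, mul_zero]

theorem IsTest.integrable_mul (h : IsTest O φ) (hO : IsOpen O) {u : E3 → ℝ}
    (hu : ContinuousOn u O) : Integrable fun z => u z * φ z := by
  have hs : tsupport (fun z => u z * φ z) ⊆ tsupport φ :=
    closure_mono (Function.support_mul_subset_right u φ)
  exact (ContinuousOn.continuous_of_tsupport_subset (hu.mul h.1.continuous.continuousOn) hO
    (hs.trans h.2.2)).integrable_of_hasCompactSupport h.2.1.mul_left

theorem IsTest.integrable_mul_memLp (h : IsTest O φ) {g : E3 → ℝ}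
    (hg : MemLp g 2 (volume.restrict O)) : IntegrableOn (fun z => g z * φ z) O :=
  hg.integrable_mul ((h.1.continuous.memLp_of_hasCompactSupport h.2.1 : MemLp φ 2 volume).restrict O)

/-- Integration by parts of a continuously differentiable function against a test function. -/
theorem integral_partialDeriv_mul (hO : IsOpen O) {f : E3 → ℝ} (hf : ContDiffOn ℝ 1 f O)
    (h : IsTest O φ) (i : Fin 3) :
    ∫ z in O, partialDeriv i f z * φ z = -∫ z in O, f z * partialDeriv i φ z := by
  have hfd : ContinuousOn (partialDeriv i f) O :=
    (hf.continuousOn_fderiv_of_isOpen hO le_rfl).clm_apply continuousOn_const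
  have i1 := h.integrable_mul hO hfd
  have i2 := (h.partialDeriv i).integrable_mul hO hf.continuousOn
  have i3 := h.integrable_mul hO hf.continuousOn
  have hd : ∀ z, HasLineDerivAt ℝ (fun z => f z * φ z)
      (partialDeriv i f z * φ z + f z * partialDeriv i φ z) z (EuclideanSpace.single i 1) := by
    intro z
    by_cases hz : z ∈ O
    · have h1 := ((hf.contDiffAt (hO.mem_nhds hz)).differentiableAt one_ne_zero).hasFDerivAt.mul
        ((h.1.differentiable (by simp)) z).hasFDerivAt
      have h2 := h1.hasLineDerivAt (EuclideanSpace.single i 1)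
      have e : partialDeriv i f z * φ z + f z * partialDeriv i φ z
          = (f z • fderiv ℝ φ z + φ z • fderiv ℝ f z) (EuclideanSpace.single i 1) := by
        simp only [SobolevDomain.partialDeriv, add_apply, smul_apply, smul_eq_mul]
        ring
      rw [e]
      exact h2
    · have hz' : z ∉ tsupport φ := fun h' => hz (h.2.2 h')
      have e : (fun z => f z * φ z) =ᶠ[𝓝 z] fun _ => 0 := by
        filter_upwards [notMem_tsupport_iff_eventuallyEq.mp hz'] with z' hz'
        rw [hz', Pi.zero_apply, mul_zero]
      rw [h.eq_zero hz, (h.partialDeriv i).eq_zero hz, mul_zero, mul_zero, add_zero]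
      have h0 := ((hasFDerivAt_const (𝕜 := ℝ) (0 : ℝ) z).congr_of_eventuallyEq e).hasLineDerivAt
        (EuclideanSpace.single i 1)
      simpa using h0
  -- With the constant `1` as second factor, integration by parts says that the derivative of `f φ`
  -- integrates to zero over the whole space.
  have key := integral_bilinear_hasLineDerivAt_right_eq_neg_left_of_integrable
    (B := ContinuousLinearMap.mul ℝ ℝ) (μ := (volume : Measure E3))
    (f := fun z => f z * φ z) (f' := fun z => partialDeriv i f z * φ z + f z * partialDeriv i φ z)
    (g := fun _ => (1 : ℝ)) (g' := fun _ => (0 : ℝ)) (v := EuclideanSpace.single i 1)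
    (by simpa [Pi.add_def] using i1.add i2) (by simp) (by simpa using i3) (fun z _ => hd z)
    (fun z _ => by simpa using (hasFDerivAt_const (𝕜 := ℝ) (1 : ℝ) z).hasLineDerivAt _)
  simp only [ContinuousLinearMap.mul_apply', mul_zero, mul_one, integral_zero] at key
  rw [integral_add i1 i2] at key
  rw [h.setIntegral, (h.partialDeriv i).setIntegral]
  linarith

theorem MemH.of_succ : ∀ {m : ℕ} {O : Set E3} {f : E3 → ℝ}, MemH (m + 1) O f → MemH m O f
  | 0, _, _, h => h.1
  | _ + 1, _, _, h => ⟨h.1, fun i => let ⟨g, hg, hg'⟩ := h.2 i; ⟨g, hg, hg'.of_succ⟩⟩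

theorem MemH.mono {m n : ℕ} (hmn : m ≤ n) {f : E3 → ℝ} (h : MemH n O f) : MemH m O f := by
  induction n, hmn using Nat.le_induction with
  | base => exact h
  | succ n _ ih => exact ih h.of_succ

/-- The classical first derivatives of a function in `H³` have a square integrable weak
Laplacian. -/
theorem exists_weakLap_partialDeriv (hO : IsOpen O) {f : E3 → ℝ} (hf : ContDiffOn ℝ 1 f O)
    (hH : MemH 3 O f) (j : Fin 3) :
    ∃ L : E3 → ℝ, MemLp L 2 (volume.restrict O) ∧ ∀ φ, IsTest O φ →
      ∫ z in O, partialDeriv j f z * lap φ z = ∫ z in O, L z * φ z := by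
  obtain ⟨g, hg, hgH⟩ := hH.2 j
  choose g1 hg1 hg1H using hgH.2
  have h2 : ∀ i, ∃ q, HasWeakPartial O i (g1 i) q ∧ MemH 0 O q := fun i => (hg1H i).2 i
  choose q hq hqH using h2
  refine ⟨fun z => ∑ i, q i z, memLp_finsetSum _ fun i _ => hqH i, fun φ hφ => ?_⟩
  have hfd : ContinuousOn (partialDeriv j f) O :=
    (hf.continuousOn_fderiv_of_isOpen hO le_rfl).clm_apply continuousOn_const
  -- The classical derivative is first exchanged for the weak one by testing both against `∂ᵢ∂ᵢφ`;
  -- two more weak derivatives then take the remaining derivatives off `φ`.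
  have hterm : ∀ i, ∫ z in O, partialDeriv j f z * partialDeriv i (partialDeriv i φ) z
      = ∫ z in O, q i z * φ z := by
    intro i
    have t1 := hφ.partialDeriv i
    have t2 := t1.partialDeriv i
    have e1 := integral_partialDeriv_mul hO hf t2 j
    have e2 := hg _ t2.1 t2.2.1 t2.2.2
    have e3 := hg1 i _ t1.1 t1.2.1 t1.2.2
    have e4 := hq i _ hφ.1 hφ.2.1 hφ.2.2
    simp only [partialDeriv] at *
    linarith
  have hl : ∀ z, partialDeriv j f z * lap φ z
      = ∑ i, partialDeriv j f z * partialDeriv i (partialDeriv i φ) z := by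
    intro z
    rw [← Finset.mul_sum]
    rfl
  simp only [hl, Finset.sum_mul]
  rw [integral_finsetSum, integral_finsetSum]
  · exact Finset.sum_congr rfl fun i _ => hterm i
  · exact fun i _ => hφ.integrable_mul_memLp (hqH i)
  · exact fun i _ => (((hφ.partialDeriv i).partialDeriv i).integrable_mul hO hfd).integrableOn

/-- The first derivatives of a function in `C¹ ∩ H³` of a ball are differentiable at almost every
point of the equatorial plane. -/
theorem ae_differentiableAt_partialDeriv {f : E3 → ℝ} {R : ℝ}
    (hf : ContDiffOn ℝ 1 f (Metric.ball 0 R)) (hH : MemH 3 (Metric.ball 0 R) f) (j : Fin 3) :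
    ∀ᵐ y ∂(volume.restrict (Metric.ball (0 : E2) R)),
      DifferentiableAt ℝ (partialDeriv j f) (flat y) := by
  obtain ⟨L, hL, hw⟩ := exists_weakLap_partialDeriv Metric.isOpen_ball hf hH j
  have hfd : ContinuousOn (partialDeriv j f) (Metric.ball 0 R) :=
    (hf.continuousOn_fderiv_of_isOpen Metric.isOpen_ball le_rfl).clm_apply continuousOn_const
  -- The potential argument needs continuity up to the closed ball, so the ball is exhausted by
  -- slightly smaller ones.
  have hn : ∀ n : ℕ, ∀ᵐ y : E2, y ∈ Metric.ball (0 : E2) (R - 1 / ((n : ℝ) + 1)) →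
      DifferentiableAt ℝ (partialDeriv j f) (flat y) := by
    intro n
    have hlt : R - 1 / ((n : ℝ) + 1) < R := sub_lt_self _ Nat.one_div_pos_of_nat
    have hsub := Metric.ball_subset_ball (x := (0 : E3)) hlt.le
    rw [← ae_restrict_iff' measurableSet_ball]
    refine ae_differentiableAt_flat (L := L)
      (hfd.mono (Metric.closedBall_subset_ball hlt)) (hL.mono_measure (Measure.restrict_mono_set _ hsub))
      fun φ h1 h2 h3 => ?_
    have hφ : IsTest (Metric.ball 0 (R - 1 / ((n : ℝ) + 1))) φ := ⟨h1, h2, h3⟩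
    have hl : ∀ z ∉ Metric.ball (0 : E3) (R - 1 / ((n : ℝ) + 1)), lap φ z = 0 := fun z hz =>
      Finset.sum_eq_zero fun i _ => ((hφ.partialDeriv i).partialDeriv i).eq_zero hz
    have h := hw φ (hφ.mono hsub)
    rw [(hφ.mono hsub).setIntegral] at h
    rw [hφ.setIntegral, ← h,
      setIntegral_eq_integral_of_forall_compl_eq_zero fun z hz => by rw [hl z hz, mul_zero],
      setIntegral_eq_integral_of_forall_compl_eq_zero fun z hz => by
        rw [hl z fun h' => hz (hsub h'), mul_zero]]
  rw [ae_restrict_iff' measurableSet_ball]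
  filter_upwards [ae_all_iff.mpr hn] with y hy hyR
  obtain ⟨n, hn⟩ := exists_nat_one_div_lt (sub_pos.mpr (mem_ball_zero_iff.mp hyR))
  exact hy n (mem_ball_zero_iff.mpr (by linarith))

theorem BoundaryChart.ae_differentiableAt_fderiv_surf {Ω : Set E3} (c : BoundaryChart 1 Ω)
    (hH : MemHVec 3 (Metric.ball 0 c.radius) c.toFun) :
    ∀ᵐ y ∂(volume.restrict (Metric.ball (0 : E2) c.radius)),
      DifferentiableAt ℝ (fderiv ℝ c.surf) y := by
  have hcomp : ∀ i : Fin 3, ContDiffOn ℝ 1 (fun z => c.toFun z i) (Metric.ball 0 c.radius) :=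
    fun i => (EuclideanSpace.proj i : E3 →L[ℝ] ℝ).contDiff.comp_contDiffOn c.contDiffOn_toFun
  have hae : ∀ᵐ y ∂(volume.restrict (Metric.ball (0 : E2) c.radius)), ∀ i j : Fin 3,
      DifferentiableAt ℝ (partialDeriv j fun z => c.toFun z i) (flat y) :=
    ae_all_iff.mpr fun i => ae_all_iff.mpr fun j =>
      ae_differentiableAt_partialDeriv (hcomp i) (hH i) j
  filter_upwards [hae, ae_restrict_mem measurableSet_ball] with y hy hyr
  have hp := flat_mem_ball.mpr hyr
  -- Rebuilding the derivative from its nine entries makes it differentiable wherever all of them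
  -- are.
  have hexp : fderiv ℝ c.toFun =ᶠ[𝓝 (flat y)] fun z => ∑ i : Fin 3, ∑ j : Fin 3,
      partialDeriv j (fun z => c.toFun z i) z •
        (EuclideanSpace.proj j : E3 →L[ℝ] ℝ).smulRight (EuclideanSpace.single i (1 : ℝ)) := by
    filter_upwards [Metric.isOpen_ball.mem_nhds hp] with z hz
    have hd := ((c.contDiffAt_toFun hz).differentiableAt one_ne_zero).hasFDerivAt
    have hpd : ∀ i j : Fin 3, partialDeriv j (fun z => c.toFun z i) z
        = fderiv ℝ c.toFun z (EuclideanSpace.single j 1) i := by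
      intro i j
      have h1 : HasFDerivAt (fun z => c.toFun z i) _ z :=
        ((EuclideanSpace.proj i : E3 →L[ℝ] ℝ).hasFDerivAt (x := c.toFun z)).comp z hd
      rw [partialDeriv, h1.fderiv]
      rfl
    ext v k
    rw [clm_apply_coord]
    simp only [hpd, Fin.sum_univ_three, add_apply, smul_apply, ContinuousLinearMap.smulRight_apply,
      PiLp.proj_apply, PiLp.add_apply, PiLp.smul_apply, smul_eq_mul]
    fin_cases k <;> simp <;> ring
  have h1 : DifferentiableAt ℝ (fderiv ℝ c.toFun) (flat y) := by
    refine DifferentiableAt.congr_of_eventuallyEq ?_ hexp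
    exact DifferentiableAt.fun_sum fun i _ => DifferentiableAt.fun_sum fun j _ =>
      (hy i j).smul_const _
  have h2 : fderiv ℝ c.surf =ᶠ[𝓝 y] fun z => (fderiv ℝ c.toFun (flat z)).comp flat := by
    filter_upwards [c.eventually_mem_ball hyr] with z hz using (c.hasFDerivAt_surf hz).fderiv
  refine DifferentiableAt.congr_of_eventuallyEq ?_ h2
  exact (DifferentiableAt.comp (f := flat) y h1 flat.differentiableAt).clm_comp
    (differentiableAt_const _)

end

end SobolevDomain

end

theorem mainTheorem10 (k : ℕ) (hk : (3 : ℝ) / 2 < k) (Ω : Set E3)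
    (hΩ : IsBoundedHDomain (k + 1) Ω)
    (N : E3 → E3) (hN : ∀ x ∈ frontier Ω, IsOutwardUnitNormal Ω x (N x))
    (w : E3 → E3) (hw : DifferentiableOn ℝ w (closure Ω))
    (c : BoundaryChart 1 Ω) :
    (∀ y ∈ Metric.ball (0 : E2) c.radius,
      tanProj (N (c.surf y)) (normalDeriv Ω w (N (c.surf y)) (c.surf y))
        = cross (curl Ω w (c.surf y)) (N (c.surf y)) + tanGradDot w N c.surf y) ∧
    (∀ y ∈ Metric.ball (0 : E2) c.radius, DifferentiableAt ℝ (fderiv ℝ c.surf) y →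
      divergence Ω w (c.surf y)
          = inner ℝ (normalDeriv Ω w (N (c.surf y)) (c.surf y)) (N (c.surf y))
            + 2 * meanCurvature N c.surf y * inner ℝ (w (c.surf y)) (N (c.surf y))
            + surfDiv (fun x => tanProj (N x) (w x)) c.surf y ∧
      inner ℝ (curl Ω w (c.surf y)) (N (c.surf y))
          = surfDiv (fun x => cross (w x) (N x)) c.surf y) ∧
    (MemHVec (k + 1) (Metric.ball 0 c.radius) c.toFun →
      ∀ᵐ y ∂(volume.restrict (Metric.ball (0 : E2) c.radius)),
        DifferentiableAt ℝ (fderiv ℝ c.surf) y) := by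
  refine ⟨fun y hy => tanProj_normalDeriv_eq c hw hN hy,
    fun y hy h2 => ⟨divergence_eq c hw hN hy h2, inner_curl_normal_eq c hw hN hy h2⟩,
    fun hH => c.ae_differentiableAt_fderiv_surf fun i => (hH i).mono ?_⟩
  have h1 : (1 : ℝ) < k := by linarith
  have h2 : 1 < k := by exact_mod_cast h1
  omega
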